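/- A digraph is finite. An out-tree of a digraph $D$ is a subdigraph $T$ of $D$ that is an oriented tree (no directed 2-cycles, and its underlying undirected graph is a tree) with exactly one vertex of in-degree zero; the leaves of $T$ are its vertices of out-degree zero. Let $\ell(D)$ be the maximum number of leaves of an out-tree of $D$ (and $0$ if $D$ has no vertices). The problem $k$-DMLOT asks, given a digraph $D$ and a positive integer $k$ (the parameter), whether $\ell(D)\ge k$. **Theorem 4.4.** $k$-DMLOT is fixed-parameter tractable on the class of all digraphs. That is, there are a single algorithm (a program of a random access machine with uniform cost measure whose arithmetic operations are addition, truncated subtraction and halving), a function $f:\mathbb N\to\mathbb N$ and a constant $c$ such that for every digraph $D$, presented by its adjacency matrix as a binary word $w$, and every positive integer $k$, the algorithm on input $(w,k)$ halts after at most $f(k)\,(|w|+1)^{c}$ steps and answers correctly whether $\ell(D)\ge k$. Moreover, for every other pair $(w,k)$, i.e. when $k=0$ or the binary word $w$ is not the adjacency matrix of a digraph, it halts within the same bound and rejects. (Loops are permitted in $D$; they never belong to an out-tree.) -/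

import Mathlib

/-!
Random access machines with uniform cost, fixed-parameter tractability, out-trees of digraphs, and
the parameterized problem k-DMLOT.
-/

namespace RAM

/-- A state of the machine: finitely many of the registers `reg 0, reg 1, …` are named by a program,
and the memory cells `mem 0, mem 1, …` are reached by indirect addressing. All hold naturals. -/
@[ext]
structure State where
  reg : ℕ → ℕ
  mem : ℕ → ℕ

namespace State

/-- Write `v` into register `x`. -/
def setReg (s : State) (x v : ℕ) : State := { s with reg := Function.update s.reg x v }

/-- Write `v` into memory cell `a`. -/
def setMem (s : State) (a v : ℕ) : State := { s with mem := Function.update s.mem a v }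

end State

/-- The elementary instructions: constants, addition, truncated subtraction, halving (rounded down),
and indirect reading and writing of the memory. There is no multiplication, so in `t` steps numbers
grow by `O(t)` bits only and the uniform cost measure is polynomially related to the running time of
Turing machines. -/
inductive Instr where
  | skip : Instr
  | const (x c : ℕ) : Instr
  | copy (x y : ℕ) : Instr
  | add (x y z : ℕ) : Instr
  | sub (x y z : ℕ) : Instr
  | half (x y : ℕ) : Instr
  | load (x y : ℕ) : Instr
  | store (x y : ℕ) : Instr

/-- The effect of an elementary instruction. -/
def Instr.eval : Instr → State → State
  | .skip, s => s
  | .const x c, s => s.setReg x c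
  | .copy x y, s => s.setReg x (s.reg y)
  | .add x y z, s => s.setReg x (s.reg y + s.reg z)
  | .sub x y z, s => s.setReg x (s.reg y - s.reg z)
  | .half x y, s => s.setReg x (s.reg y / 2)
  | .load x y, s => s.setReg x (s.mem (s.reg y))
  | .store x y, s => s.setMem (s.reg x) (s.reg y)

/-- Programs: elementary instructions combined by sequencing, branching and loops; the tests ask
whether a register is nonzero. -/
inductive Prog where
  | instr (i : Instr) : Prog
  | seq (p q : Prog) : Prog
  | ite (x : ℕ) (p q : Prog) : Prog
  | while (x : ℕ) (p : Prog) : Prog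

/-- `Exec p s t s'`: started in state `s`, the program `p` halts in state `s'` after exactly `t`
steps, where every elementary instruction and every test executed counts as one step. -/
inductive Exec : Prog → State → ℕ → State → Prop where
  | instr (i : Instr) (s : State) : Exec (.instr i) s 1 (i.eval s)
  | seq {p q : Prog} {s s' s'' : State} {t t' : ℕ} :
      Exec p s t s' → Exec q s' t' s'' → Exec (.seq p q) s (t + t') s''
  | iteTrue {x : ℕ} {p q : Prog} {s s' : State} {t : ℕ} :
      s.reg x ≠ 0 → Exec p s t s' → Exec (.ite x p q) s (t + 1) s'
  | iteFalse {x : ℕ} {p q : Prog} {s s' : State} {t : ℕ} :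
      s.reg x = 0 → Exec q s t s' → Exec (.ite x p q) s (t + 1) s'
  | whileTrue {x : ℕ} {p : Prog} {s s' s'' : State} {t t' : ℕ} :
      s.reg x ≠ 0 → Exec p s t s' → Exec (.while x p) s' t' s'' →
        Exec (.while x p) s (t + t' + 1) s''
  | whileFalse {x : ℕ} {p : Prog} {s : State} :
      s.reg x = 0 → Exec (.while x p) s 1 s

/-- The machine is deterministic: the final state and the number of steps are determined. -/
theorem Exec.unique {p : Prog} {s s₁ s₂ : State} {t₁ t₂ : ℕ} (h₁ : Exec p s t₁ s₁)
    (h₂ : Exec p s t₂ s₂) : t₁ = t₂ ∧ s₁ = s₂ := by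
  induction h₁ generalizing t₂ s₂ with
  | instr i s => cases h₂; exact ⟨rfl, rfl⟩
  | seq _ _ ih₁ ih₂ =>
    cases h₂ with
    | seq a b =>
      obtain ⟨rfl, rfl⟩ := ih₁ a
      obtain ⟨rfl, rfl⟩ := ih₂ b
      exact ⟨rfl, rfl⟩
  | iteTrue hx _ ih =>
    cases h₂ with
    | iteTrue _ a => obtain ⟨rfl, rfl⟩ := ih a; exact ⟨rfl, rfl⟩
    | iteFalse hx' _ => exact absurd hx' hx
  | iteFalse hx _ ih =>
    cases h₂ with
    | iteTrue hx' _ => exact absurd hx hx'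
    | iteFalse _ a => obtain ⟨rfl, rfl⟩ := ih a; exact ⟨rfl, rfl⟩
  | whileTrue hx _ _ ih₁ ih₂ =>
    cases h₂ with
    | whileTrue _ a b =>
      obtain ⟨rfl, rfl⟩ := ih₁ a
      obtain ⟨rfl, rfl⟩ := ih₂ b
      exact ⟨rfl, rfl⟩
    | whileFalse hx' => exact absurd hx' hx
  | whileFalse hx =>
    cases h₂ with
    | whileTrue hx' _ _ => exact absurd hx hx'
    | whileFalse _ => exact ⟨rfl, rfl⟩

/-- The initial state on input `(w, k)`: register `0` holds the length of the word `w`, register `1`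
holds the parameter `k`, memory cell `i` holds the `i`-th letter of `w` (as `0` or `1`), and all the
other registers and cells hold `0`. -/
def initState (w : List Bool) (k : ℕ) : State where
  reg := Function.update (Function.update (fun _ => 0) 1 k) 0 w.length
  mem := fun i => (w.getD i false).toNat

end RAM

/-- A parameterized problem is a set of pairs `(w, k)` of a binary word and a parameter. It is
fixed-parameter tractable if a single program decides for every `(w, k)` whether it belongs to the
problem (the answer is "yes" if register `0` is nonzero on halting), in at most
`f(k) · (|w| + 1) ^ c` steps, where the function `f` and the constant `c` do not depend on the
input. -/
def IsFPT (L : Set (List Bool × ℕ)) : Prop :=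
  ∃ (p : RAM.Prog) (f : ℕ → ℕ) (c : ℕ), ∀ (w : List Bool) (k : ℕ),
    ∃ (t : ℕ) (s : RAM.State), RAM.Exec p (RAM.initState w k) t s ∧
      t ≤ f k * (w.length + 1) ^ c ∧ (s.reg 0 ≠ 0 ↔ (w, k) ∈ L)

namespace Digraph

/-- `T` is an out-tree, as a digraph of its own: it is an oriented tree (no directed 2-cycles or
loops, and the underlying undirected graph is a tree) with exactly one vertex of in-degree zero. -/
structure IsOutTree {W : Type*} (T : Digraph W) : Prop where
  oriented : ∀ u v, T.Adj u v → ¬ T.Adj v u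
  isTree : T.toSimpleGraphInclusive.IsTree
  existsUnique_root : ∃! s, ∀ u, ¬ T.Adj u s

/-- The leaves of `T`: the vertices of out-degree zero. -/
def leaves {W : Type*} (T : Digraph W) : Set W := {v | ∀ w, ¬ T.Adj v w}

/-- `D` has a subdigraph `T`, with vertex set `S`, that is an out-tree with exactly `m` leaves. -/
def HasOutTree {V : Type*} (D : Digraph V) (m : ℕ) : Prop :=
  ∃ (S : Set V) (T : Digraph S), (∀ u v : S, T.Adj u v → D.Adj u v) ∧
    T.IsOutTree ∧ T.leaves.ncard = m

/-- `ℓ(D)`: the maximum number of leaves of an out-tree of a finite digraph `D` (and `0` for the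
digraph without vertices, which has no out-tree). -/
noncomputable def maxLeaves {V : Type*} (D : Digraph V) : ℕ := sSup {m | D.HasOutTree m}

/-- For a finite digraph the set in the definition of `ℓ(D)` is bounded, so that `ℓ(D)` is a true
maximum: `ℓ(D) ≥ k` if and only if there is an out-tree with at least `k` leaves. -/
theorem le_maxLeaves_iff {V : Type*} [Finite V] (D : Digraph V) {k : ℕ} (hk : 0 < k) :
    k ≤ D.maxLeaves ↔ ∃ m, k ≤ m ∧ D.HasOutTree m := by
  have hb : BddAbove {m | D.HasOutTree m} := by
    refine ⟨Nat.card V, ?_⟩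
    rintro m ⟨S, T, -, -, rfl⟩
    exact (Set.ncard_le_card _).trans (Finite.card_subtype_le _)
  constructor
  · intro h
    have hne : {m | D.HasOutTree m}.Nonempty := by
      by_contra hne
      rw [Set.not_nonempty_iff_eq_empty] at hne
      simp [maxLeaves, hne] at h
      omega
    exact ⟨_, h, Nat.sSup_mem hne hb⟩
  · rintro ⟨m, hkm, hm⟩
    exact hkm.trans (le_csSup hb hm)

open Classical in
/-- The binary word that presents a digraph on the vertices `0, …, n - 1`: its adjacency matrix,
row by row. -/
noncomputable def encode {n : ℕ} (D : Digraph (Fin n)) : List Bool :=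
  List.ofFn fun p : Fin (n * n) => decide (D.Adj p.divNat p.modNat)

end Digraph

/-- The parameterized problem k-DMLOT: given a digraph `D` and a positive integer `k`, is
`ℓ(D) ≥ k`? -/
def kDMLOT : Set (List Bool × ℕ) :=
  {x | 0 < x.2 ∧ ∃ (n : ℕ) (D : Digraph (Fin n)), x.1 = D.encode ∧ x.2 ≤ D.maxLeaves}

/-! Having an out-tree with at least `k` leaves is equivalent to having a root `r`, a set `A`
reachable from `r` inside itself, and `k` vertices outside `A` that are `r` or out-neighbours of
`A`: take inner vertices and leaves in one direction, a breadth-first tree in the other. This is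
`le_maxLeaves_iff_hasBoundary`; it removes trees from the problem.

For a fixed root, a search tree is grown by bounded branching. A stack holds the undecided leaves.
The top vertex either stays a leaf for good, or becomes inner and receives all its unseen
out-neighbours as children. Each decision is read from one bit of a guessed number. If the new inner
vertex has exactly one child, that child must become inner, and no bit is spent on it.

Forcing is harmless because of `Valid.minimal`: let `I` be the inner set of a witness of least
cardinality. If `u` in `I` had no unseen out-neighbour, or only one and that one outside `I`, then
deleting `u` from `I` and letting `u` replace that neighbour in the boundary would give a smaller
witness. Let the guesses follow `I`. Then `2 * leaves - stack length`, with one extra unit while a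
move is forced, goes up with every bit spent and never goes down, so `2 * k` bits suffice
(`exists_guesses`). Conversely every run of the search describes a genuine boundary
(`Valid.hasBoundary`), so trying all `4 ^ k` guesses from every root decides the problem
(`exists_leaves_iff`).

Each of the `n` search steps scans at most one row of the adjacency matrix. The total is `4 ^ k`
times a cubic polynomial in `n`, plus the cost of computing `4 ^ k` and `n`. The rest of the proof
realises the search on the machine with this bound (`runs_main`) and identifies words of square
length with digraphs (`mem_kDMLOT_iff`). -/

namespace Digraph

/-! ### Out-trees and boundaries of reachable sets. -/

/-- Every vertex of `A` is reachable from `r` by a walk all of whose sources lie in `A`. -/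
def ReachableWithin {V : Type*} (adj : V → V → Prop) (r : V) (A : Finset V) : Prop :=
  ∀ a ∈ A, Relation.ReflTransGen (fun x y => x ∈ A ∧ adj x y) r a

/-- There is a set `A` reachable from `r` within itself, and at least `k` vertices outside of `A`
each of which is `r` or an out-neighbour of `A`. -/
def HasBoundary {V : Type*} (adj : V → V → Prop) (r : V) (k : ℕ) : Prop :=
  ∃ A B : Finset V, ReachableWithin adj r A ∧
    (∀ v ∈ B, v ∉ A ∧ (v = r ∨ ∃ a ∈ A, adj a v)) ∧ k ≤ B.card

/-- A parent function that decreases a rank defines an out-tree. -/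
theorem isOutTree_of_parent {W : Type*} [Finite W] (r : W) (par : W → W) (rank : W → ℕ)
    (h : ∀ v, v ≠ r → rank (par v) < rank v) :
    (Digraph.mk fun p v => v ≠ r ∧ par v = p : Digraph W).IsOutTree := by
  set T : Digraph W := Digraph.mk fun p v => v ≠ r ∧ par v = p with hT
  have hlt : ∀ {u v}, T.Adj u v → rank u < rank v := by
    rintro u v ⟨h1, rfl⟩; exact h v h1
  have hadj : ∀ v, v ≠ r → T.toSimpleGraphInclusive.Adj (par v) v := by
    intro v hv
    refine ⟨fun he => ?_, Or.inl ⟨hv, rfl⟩⟩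
    have := h v hv
    rw [he] at this
    omega
  have hconn : T.toSimpleGraphInclusive.Connected := by
    have key : ∀ m v, rank v = m → T.toSimpleGraphInclusive.Reachable r v := by
      intro m
      induction m using Nat.strong_induction_on with
      | _ m ih =>
        intro v hv
        by_cases hr : v = r
        · subst hr; exact SimpleGraph.Reachable.refl _
        · exact (ih _ (hv ▸ h v hr) _ rfl).trans (hadj v hr).reachable
    have : Nonempty W := ⟨r⟩
    exact SimpleGraph.Connected.mk fun u v => (key _ u rfl).symm.trans (key _ v rfl)
  refine ⟨fun u v huv hvu => ?_, ?_, ⟨r, fun u hu => hu.1 rfl, fun s hs => ?_⟩⟩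
  · have := hlt huv; have := hlt hvu; omega
  -- Sending a non-root to the edge joining it to its parent hits every edge, so there are at most
  -- `|W| - 1` edges; a connected graph has no fewer.
  · rw [SimpleGraph.isTree_iff_connected_and_card]
    refine ⟨hconn, le_antisymm ?_ hconn.card_vert_le_card_edgeSet_add_one⟩
    let f : {v // v ≠ r} → T.toSimpleGraphInclusive.edgeSet := fun v =>
      ⟨s(par v.1, v.1), hadj v.1 v.2⟩
    have hf : Function.Surjective f := by
      rintro ⟨e, he⟩
      induction e using Sym2.ind with
      | _ x y =>
        rcases he with ⟨hne, ⟨h1, h2⟩ | ⟨h1, h2⟩⟩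
        · exact ⟨⟨y, h1⟩, by simp [f, h2]⟩
        · exact ⟨⟨x, h1⟩, by simp [f, h2, Sym2.eq_swap]⟩
    have h1 := Nat.card_le_card_of_surjective f hf
    have h2 : Nat.card {v // v ≠ r} + 1 = Nat.card W := by
      classical
      have := Fintype.ofFinite W
      have h0 : 0 < Fintype.card W := Fintype.card_pos_iff.2 ⟨r⟩
      rw [Nat.card_eq_fintype_card, Nat.card_eq_fintype_card, Fintype.card_subtype_compl,
        Fintype.card_subtype_eq]
      omega
    omega
  · by_contra hne
    exact hs (par s) ⟨hne, rfl⟩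

/-- Choose one in-neighbour for each non-root. The chosen edges are distinct since there are no
2-cycles, and a tree has exactly as many edges as non-roots. So every arc is the chosen one of its
head. -/
theorem IsOutTree.parent_unique {W : Type*} [Finite W] {T : Digraph W} (hT : T.IsOutTree)
    {x x' y : W} (h : T.Adj x y) (h' : T.Adj x' y) : x = x' := by
  obtain ⟨r, hr, hru⟩ := hT.existsUnique_root
  have hp : ∀ v : {v // v ≠ r}, ∃ p, T.Adj p v.1 := by
    rintro ⟨v, hv⟩
    by_contra hcon
    push Not at hcon
    exact hv (hru v hcon)
  choose par hpar using hp
  have hne : ∀ {a b}, T.Adj a b → a ≠ b := by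
    rintro a _ hab rfl
    exact hT.oriented _ _ hab hab
  let f : {v // v ≠ r} → T.toSimpleGraphInclusive.edgeSet := fun v =>
    ⟨s(par v, v.1), hne (hpar v), Or.inl (hpar v)⟩
  have hf : Function.Injective f := by
    intro a b hab
    replace hab : s(par a, a.1) = s(par b, b.1) := congrArg Subtype.val hab
    rw [Sym2.eq_iff] at hab
    rcases hab with ⟨-, h2⟩ | ⟨h1, h2⟩
    · exact Subtype.ext h2
    · exact absurd (h2 ▸ hpar b) (hT.oriented _ _ (h1 ▸ hpar a))
  have hcard := (SimpleGraph.isTree_iff_connected_and_card.1 hT.isTree).2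
  have h2 : Nat.card {v // v ≠ r} + 1 = Nat.card W := by
    classical
    have := Fintype.ofFinite W
    have h0 : 0 < Fintype.card W := Fintype.card_pos_iff.2 ⟨r⟩
    rw [Nat.card_eq_fintype_card, Nat.card_eq_fintype_card, Fintype.card_subtype_compl,
      Fintype.card_subtype_eq]
    omega
  have hb := hf.bijective_of_nat_card_le (by omega)
  have key : ∀ {x y} (hxy : T.Adj x y), ∃ hy : y ≠ r, x = par ⟨y, hy⟩ := by
    intro x y hxy
    obtain ⟨⟨z, hz⟩, hzf⟩ := hb.2 ⟨s(x, y), hne hxy, Or.inl hxy⟩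
    replace hzf : s(par ⟨z, hz⟩, z) = s(x, y) := congrArg Subtype.val hzf
    rw [Sym2.eq_iff] at hzf
    rcases hzf with ⟨h1, rfl⟩ | ⟨h1, rfl⟩
    · exact ⟨hz, h1.symm⟩
    · exact absurd (h1 ▸ hpar ⟨z, hz⟩) (hT.oriented _ _ hxy)
  obtain ⟨_, h1⟩ := key h
  obtain ⟨_, h2⟩ := key h'
  rw [h1, h2]

/-- Follow an undirected walk from the root. An edge taken against its direction leads to the parent
of the current vertex, which by uniqueness is the last vertex before it on the directed walk already
found. -/
theorem IsOutTree.reachable {W : Type*} [Finite W] {T : Digraph W} (hT : T.IsOutTree) {r : W}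
    (hr : ∀ u, ¬ T.Adj u r) (v : W) : Relation.ReflTransGen T.Adj r v := by
  have key : ∀ u v, T.toSimpleGraphInclusive.Adj u v → Relation.ReflTransGen T.Adj r u →
      Relation.ReflTransGen T.Adj r v := by
    rintro u v ⟨-, h | h⟩ hu
    · exact hu.tail h
    · rcases Relation.ReflTransGen.cases_tail hu with rfl | ⟨x, hx, hxu⟩
      · exact absurd h (hr v)
      · exact hT.parent_unique hxu h ▸ hx
  obtain ⟨p⟩ := hT.isTree.connected.preconnected r v
  suffices ∀ {u v} (_ : T.toSimpleGraphInclusive.Walk u v), Relation.ReflTransGen T.Adj r u →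
      Relation.ReflTransGen T.Adj r v from this p .refl
  intro u v p
  induction p with
  | nil => exact id
  | cons h _ ih => exact fun hu => ih (key _ _ h hu)

/-- The witnesses are the inner vertices and the leaves of the tree. -/
theorem HasOutTree.hasBoundary {V : Type*} [Finite V] {D : Digraph V} {m : ℕ}
    (h : D.HasOutTree m) : ∃ r, HasBoundary D.Adj r m := by
  classical
  obtain ⟨S, T, hTD, hT, rfl⟩ := h
  obtain ⟨r, hr, hru⟩ := hT.existsUnique_root
  have := Fintype.ofFinite S
  refine ⟨r, ({v : S | ∃ w, T.Adj v w} : Finset S).map (.subtype _),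
    ({v : S | v ∈ T.leaves} : Finset S).map (.subtype _), ?_, ?_, ?_⟩
  · intro a ha
    obtain ⟨a, -, rfl⟩ := Finset.mem_map.1 ha
    refine Relation.ReflTransGen.lift (fun x : S => (x : V)) ?_ r a (hT.reachable hr a)
    intro x y hxy
    exact ⟨by simpa using ⟨y, y.2, hxy⟩, hTD _ _ hxy⟩
  · intro v hv
    obtain ⟨v, hvl, rfl⟩ := Finset.mem_map.1 hv
    replace hv : ∀ w, ¬ T.Adj v w := (Finset.mem_filter.1 hvl).2
    constructor
    · intro hc
      obtain ⟨v', hvc, he⟩ := Finset.mem_map.1 hc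
      obtain rfl : v' = v := Subtype.ext he
      obtain ⟨w, hw⟩ := (Finset.mem_filter.1 hvc).2
      exact hv w hw
    · by_cases hvr : v = r
      · left; rw [hvr]; rfl
      · right
        have : ∃ p, T.Adj p v := by
          by_contra hcon
          push Not at hcon
          exact hvr (hru v hcon)
        obtain ⟨p, hp⟩ := this
        exact ⟨p, by simpa using ⟨v, v.2, hp⟩, hTD _ _ hp⟩
  · rw [Finset.card_map, Set.ncard_eq_toFinset_card']
    apply Finset.card_le_card
    intro x; simp

/-- `R i v` says that `v` ends a walk of length `i` from `r` with all sources in `A`. Ranking by the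
least such `i` gives a breadth-first tree whose parents all lie in `A`, so the vertices of `B` are
leaves. -/
theorem HasBoundary.exists_hasOutTree {V : Type*} [Finite V] {D : Digraph V} {r : V} {k : ℕ}
    (h : HasBoundary D.Adj r k) : ∃ m, k ≤ m ∧ D.HasOutTree m := by
  classical
  obtain ⟨A, B, hA, hB, hk⟩ := h
  let R : ℕ → V → Prop := fun i => Nat.rec (fun v => v = r) (fun _ P v => ∃ a ∈ A, P a ∧ D.Adj a v) i
  have hR : ∀ v, Relation.ReflTransGen (fun x y => x ∈ A ∧ D.Adj x y) r v → ∃ i, R i v := by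
    intro v hv
    induction hv with
    | refl => exact ⟨0, rfl⟩
    | tail _ h ih =>
      obtain ⟨i, hi⟩ := ih
      exact ⟨i + 1, _, h.1, hi, h.2⟩
  let S : Set V := {v | ∃ i, R i v}
  have hdec : ∀ v, DecidablePred fun i => R i v := fun v => Classical.decPred _
  let rank : S → ℕ := fun v => @Nat.find (fun i => R i v) (hdec v) v.2
  let r' : S := ⟨r, 0, rfl⟩
  have hpar : ∀ v : S, ∃ p : S, v ≠ r' → (p.1 ∈ A ∧ D.Adj p v ∧ rank p < rank v) := by
    intro v
    by_cases hv : v = r'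
    -- The root gets a dummy parent, which is never used.
    · exact ⟨r', fun h => absurd hv h⟩
    · have hs : R (rank v) v := @Nat.find_spec (fun i => R i v) (hdec v) v.2
      rcases hi : rank v with _ | i
      · rw [hi] at hs
        exact absurd (Subtype.ext hs) hv
      · rw [hi] at hs
        obtain ⟨a, ha, hia, hav⟩ := hs
        exact ⟨⟨a, i, hia⟩, fun _ => ⟨ha, hav, Nat.lt_succ_of_le (@Nat.find_min' (fun i => R i a) (hdec a) _ _ hia)⟩⟩
  choose par hpar using hpar
  refine ⟨_, ?_, S, _, ?_, isOutTree_of_parent r' par rank fun v hv => (hpar v hv).2.2, rfl⟩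
  · refine hk.trans ?_
    have hBS : ∀ v ∈ B, ∃ i, R i v := by
      intro v hv
      rcases (hB v hv).2 with rfl | ⟨a, ha, hav⟩
      · exact ⟨0, rfl⟩
      · exact hR v ((hA a ha).tail ⟨ha, hav⟩)
    rw [← Set.ncard_image_of_injective _ Subtype.val_injective, ← Set.ncard_coe_finset]
    apply Set.ncard_le_ncard _ (Set.toFinite _)
    intro v hv
    refine ⟨⟨v, hBS v hv⟩, ?_, rfl⟩
    rintro w ⟨hw, hp⟩
    have := (hpar w hw).1
    rw [hp] at this
    exact (hB v hv).1 this
  · rintro u v ⟨hv, rfl⟩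
    exact (hpar v hv).2.1

theorem le_maxLeaves_iff_hasBoundary {V : Type*} [Finite V] (D : Digraph V) {k : ℕ} (hk : 0 < k) :
    k ≤ D.maxLeaves ↔ ∃ r, HasBoundary D.Adj r k := by
  rw [D.le_maxLeaves_iff hk]
  constructor
  · rintro ⟨m, hm, h⟩
    obtain ⟨r, A, B, hA, hB, hc⟩ := h.hasBoundary
    exact ⟨r, A, B, hA, hB, hm.trans hc⟩
  · rintro ⟨r, h⟩
    exact h.exists_hasOutTree

end Digraph

/-!
The search: a walk over the vertices, steered by the bits of a number, grows an out-tree from a root.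
-/

namespace LeafSearch

open Digraph

/-- A configuration of the search: the stack of undecided leaves, the set of vertices of the tree,
whether the top of the stack has to become an inner vertex, the remaining guesses, and the number of
leaves. -/
structure Config where
  stack : List ℕ
  seen : Finset ℕ
  forced : Bool
  bits : ℕ
  leaves : ℕ

/-- The initial configuration of the search from the root `r` with the guesses `b`. -/
def init (r b : ℕ) : Config := ⟨[r], {r}, false, b, 1⟩

/-! ### Invariants of the search and the guide it follows. -/

section Invariants

variable {n : ℕ} {adj : ℕ → ℕ → Prop}

/-- The search is about a tree with root `r` whose inner vertices are those of `A`. -/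
structure Valid (n : ℕ) (adj : ℕ → ℕ → Prop) (r : ℕ) (A : Finset ℕ) (c : Config) : Prop where
  nodup : c.stack.Nodup
  stack_sub : ∀ v ∈ c.stack, v ∈ c.seen ∧ v ∉ A
  inner_sub : A ⊆ c.seen
  seen_lt : ∀ v ∈ c.seen, v < n
  mem_seen : ∀ v, v ∈ c.seen ↔ v = r ∨ ∃ a ∈ A, adj a v
  leaves_eq : c.leaves = (c.seen \ A).card
  reach : ReachableWithin adj r A

theorem reachableWithin_mono {r : ℕ} {A A' : Finset ℕ} (h : A ⊆ A') {v : ℕ}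
    (hv : Relation.ReflTransGen (fun x y => x ∈ A ∧ adj x y) r v) :
    Relation.ReflTransGen (fun x y => x ∈ A' ∧ adj x y) r v :=
  Relation.ReflTransGen.mono (fun _ _ hxy => ⟨h hxy.1, hxy.2⟩) _ _ hv

theorem Valid.reach_seen {r : ℕ} {A : Finset ℕ} {c : Config} (h : Valid n adj r A c) {v : ℕ}
    (hv : v ∈ c.seen) : Relation.ReflTransGen (fun x y => x ∈ A ∧ adj x y) r v := by
  rcases (h.mem_seen v).1 hv with rfl | ⟨a, ha, hav⟩
  · exact .refl
  · exact (h.reach a ha).tail ⟨ha, hav⟩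

theorem valid_init {r : ℕ} (hr : r < n) (b : ℕ) : Valid n adj r ∅ (init r b) where
  nodup := by simp [init]
  stack_sub := by simp [init]
  inner_sub := by simp
  seen_lt := by simpa [init] using hr
  mem_seen := by simp [init]
  leaves_eq := by simp [init]
  reach := by intro a ha; simp at ha

theorem Valid.pop {r : ℕ} {A : Finset ℕ} {c : Config} (h : Valid n adj r A c) {u : ℕ}
    {rest : List ℕ} (hc : c.stack = u :: rest) (b : ℕ) :
    Valid n adj r A { c with stack := rest, bits := b } :=
  ⟨(List.nodup_cons.1 (hc ▸ h.nodup)).2, fun v hv => h.stack_sub v (by simp [hc, hv]),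
    h.inner_sub, h.seen_lt, h.mem_seen, h.leaves_eq, h.reach⟩

theorem Valid.hasBoundary {r : ℕ} {A : Finset ℕ} {c : Config} (h : Valid n adj r A c) {k : ℕ}
    (hk : k ≤ c.leaves) : HasBoundary adj r k := by
  refine ⟨A, c.seen \ A, h.reach, fun v hv => ?_, h.leaves_eq ▸ hk⟩
  rw [Finset.mem_sdiff] at hv
  exact ⟨hv.2, (h.mem_seen v).1 hv.1⟩

/-- `I` and `B` witness `HasBoundary adj r k`. -/
def Witness (adj : ℕ → ℕ → Prop) (r k : ℕ) (I B : Finset ℕ) : Prop :=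
  ReachableWithin adj r I ∧ (∀ v ∈ B, v ∉ I ∧ (v = r ∨ ∃ a ∈ I, adj a v)) ∧ k ≤ B.card

/-- The search has so far followed the guide `I`. -/
structure Follows (I A : Finset ℕ) (c : Config) : Prop where
  sub : A ⊆ I
  red : ∀ v ∈ c.seen, v ∉ A → v ∉ c.stack → v ∉ I
  forced : c.forced = true → ∃ u rest, c.stack = u :: rest ∧ u ∈ I

/-- When nothing is left to decide, the search has found a guide with at least as many leaves. -/
theorem Follows.le_leaves {r k : ℕ} {A I B : Finset ℕ} {c : Config} (hf : Follows I A c)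
    (h : Valid n adj r A c) (hw : Witness adj r k I B) (hc : c.stack = []) : k ≤ c.leaves := by
  -- Along a walk inside `I` every vertex is seen, and a seen vertex of `I` is already in `A`: the
  -- stack is empty, and only vertices outside `I` were discarded.
  have hIA : ∀ y, Relation.ReflTransGen (fun x y => x ∈ I ∧ adj x y) r y → y ∈ I → y ∈ A := by
    have key : ∀ y ∈ c.seen, y ∈ I → y ∈ A := by
      intro y hy hyI
      by_contra hyA
      exact hf.red y hy hyA (by simp [hc]) hyI
    intro y hy
    induction hy with
    | refl => exact key r ((h.mem_seen r).2 (Or.inl rfl))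
    | tail _ hab ih =>
      exact key _ ((h.mem_seen _).2 (Or.inr ⟨_, ih hab.1, hab.2⟩))
  rw [h.leaves_eq]
  refine hw.2.2.trans (Finset.card_le_card fun v hv => ?_)
  obtain ⟨hvI, hv⟩ := hw.2.1 v hv
  refine Finset.mem_sdiff.2 ⟨(h.mem_seen v).2 (hv.imp_right fun ⟨a, ha, hav⟩ =>
    ⟨a, hIA a (hw.1 a ha) ha, hav⟩), fun hvA => hvI (hf.sub hvA)⟩

theorem Follows.pop {A I : Finset ℕ} {c : Config} (hf : Follows I A c) {u : ℕ} {rest : List ℕ}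
    (hc : c.stack = u :: rest) (huI : u ∉ I) (hfo : c.forced = false) (b : ℕ) :
    Follows I A { c with stack := rest, bits := b } := by
  refine ⟨hf.sub, fun v hv hvA hvr => ?_, fun h => by simp [hfo] at h⟩
  by_cases hvu : v = u
  · exact hvu ▸ huI
  · exact hf.red v hv hvA (by simp [hc, hvu]; exact hvr)

end Invariants

variable (n : ℕ) (adj : ℕ → ℕ → Prop) [DecidableRel adj]

/-- The out-neighbours of `u` among `0, …, i - 1` that do not belong to `S`. -/
def fresh (S : Finset ℕ) (u i : ℕ) : List ℕ := (List.range i).filter fun v => adj u v ∧ v ∉ S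

/-- Make the vertex `u`, taken off the stack, an inner vertex. -/
def expand (c : Config) (u : ℕ) (rest : List ℕ) (b : ℕ) : Config where
  stack := (fresh adj c.seen u n).reverse ++ rest
  seen := c.seen ∪ (fresh adj c.seen u n).toFinset
  forced := decide ((fresh adj c.seen u n).length = 1)
  bits := b
  leaves := c.leaves + ((fresh adj c.seen u n).length - 1)

/-- Take a vertex off the stack and decide whether it becomes an inner vertex. -/
def step (c : Config) : Config :=
  match c.stack with
  | [] => c
  | u :: rest =>
    if c.forced then expand n adj c u rest c.bits
    else if c.bits % 2 = 1 then expand n adj c u rest (c.bits / 2)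
    else { c with stack := rest, bits := c.bits / 2 }

/-! ### Search steps preserve the invariants, and few guesses suffice. -/

variable {n adj}

theorem mem_fresh {S : Finset ℕ} {u v i : ℕ} : v ∈ fresh adj S u i ↔ v < i ∧ adj u v ∧ v ∉ S := by
  simp [fresh]

theorem nodup_fresh (S : Finset ℕ) (u i : ℕ) : (fresh adj S u i).Nodup :=
  List.nodup_range.filter _

theorem le_leaves_step (c : Config) : c.leaves ≤ (step n adj c).leaves := by
  unfold step
  split
  · exact le_rfl
  · split_ifs <;> simp [expand]

theorem le_leaves_iterate (c : Config) (i : ℕ) : c.leaves ≤ ((step n adj)^[i] c).leaves := by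
  induction i generalizing c with
  | zero => exact le_rfl
  | succ i ih => exact (le_leaves_step c).trans (ih _)

theorem card_union_fresh (S : Finset ℕ) (u : ℕ) :
    (S ∪ (fresh adj S u n).toFinset).card = S.card + (fresh adj S u n).length := by
  rw [Finset.card_union_of_disjoint, List.toFinset_card_of_nodup (nodup_fresh S u n)]
  rw [Finset.disjoint_left]
  intro v hv hv'
  exact (mem_fresh.1 (List.mem_toFinset.1 hv')).2.2 hv

/-- The hypothesis `hne` matters for the count: turning `u` inner loses one leaf and gains the fresh
ones, which the truncated `length - 1` records correctly only when there is a fresh one. -/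
theorem Valid.expand (hadj : ∀ u v, adj u v → v < n) {r : ℕ} {A : Finset ℕ} {c : Config}
    (h : Valid n adj r A c) {u : ℕ} {rest : List ℕ} (hc : c.stack = u :: rest) (b : ℕ)
    (hne : (fresh adj c.seen u n).length ≠ 0) :
    Valid n adj r (insert u A) (expand n adj c u rest b) := by
  have hnd := List.nodup_cons.1 (hc ▸ h.nodup)
  have hu := h.stack_sub u (by simp [hc])
  have hsub : insert u A ⊆ c.seen := Finset.insert_subset hu.1 h.inner_sub
  refine ⟨?_, ?_, hsub.trans Finset.subset_union_left, ?_, ?_, ?_, ?_⟩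
  · refine List.Nodup.append (List.nodup_reverse.2 (nodup_fresh _ _ _)) hnd.2 ?_
    intro v hv hv'
    exact (mem_fresh.1 (List.mem_reverse.1 hv)).2.2 (h.stack_sub v (by simp [hc, hv'])).1
  · intro v hv
    simp only [LeafSearch.expand, List.mem_append, List.mem_reverse] at hv
    simp only [LeafSearch.expand, Finset.mem_union, List.mem_toFinset]
    rcases hv with hv | hv
    · exact ⟨Or.inr hv, fun hi => (mem_fresh.1 hv).2.2 (hsub hi)⟩
    · have := h.stack_sub v (by simp [hc, hv])
      refine ⟨Or.inl this.1, fun hi => ?_⟩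
      rcases Finset.mem_insert.1 hi with rfl | hi
      · exact hnd.1 hv
      · exact this.2 hi
  · intro v hv
    simp only [LeafSearch.expand, Finset.mem_union, List.mem_toFinset] at hv
    exact hv.elim (h.seen_lt v) fun hv => (mem_fresh.1 hv).1
  · intro v
    simp only [LeafSearch.expand, Finset.mem_union, List.mem_toFinset, mem_fresh,
      Finset.exists_mem_insert]
    constructor
    · rintro (hv | hv)
      · exact ((h.mem_seen v).1 hv).imp_right Or.inr
      · exact Or.inr (Or.inl hv.2.1)
    · rintro (hv | hv | hv)
      · exact Or.inl ((h.mem_seen v).2 (Or.inl hv))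
      · by_cases hs : v ∈ c.seen
        · exact Or.inl hs
        · exact Or.inr ⟨hadj _ _ hv, hv, hs⟩
      · exact Or.inl ((h.mem_seen v).2 (Or.inr hv))
  · have h1 := card_union_fresh (n := n) (adj := adj) c.seen u
    have h2 := h.leaves_eq
    rw [Finset.card_sdiff_of_subset h.inner_sub] at h2
    have h3 := Finset.card_insert_of_notMem hu.2
    have h4 := Finset.card_le_card hsub
    simp only [LeafSearch.expand]
    rw [Finset.card_sdiff_of_subset (hsub.trans Finset.subset_union_left)]
    omega
  · intro a ha
    have : a ∈ c.seen := hsub ha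
    exact reachableWithin_mono (Finset.subset_insert _ _) (h.reach_seen this)

/-- A dead end remains a leaf although the guess asked to expand it, so the move acts as a pop and
the inner set need not change. -/
theorem expand_of_length_eq_zero {c : Config} {u : ℕ} (rest : List ℕ) (b : ℕ)
    (h0 : (fresh adj c.seen u n).length = 0) :
    expand n adj c u rest b = { c with stack := rest, bits := b, forced := false } := by
  have h1 := List.length_eq_zero_iff.1 h0
  simp [LeafSearch.expand, h1]

theorem Valid.step (hadj : ∀ u v, adj u v → v < n) {r : ℕ} {A : Finset ℕ} {c : Config}
    (h : Valid n adj r A c) : ∃ A', Valid n adj r A' (step n adj c) := by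
  have key : ∀ u rest b, c.stack = u :: rest →
      ∃ A', Valid n adj r A' (LeafSearch.expand n adj c u rest b) := by
    intro u rest b hc
    by_cases h0 : (fresh adj c.seen u n).length = 0
    · rw [expand_of_length_eq_zero rest b h0]
      obtain ⟨h1, h2, h3, h4, h5, h6, h7⟩ := h.pop hc b
      exact ⟨A, h1, h2, h3, h4, h5, h6, h7⟩
    · exact ⟨_, h.expand hadj hc b h0⟩
  unfold LeafSearch.step
  split
  · exact ⟨A, h⟩
  · rename_i u rest hc
    split_ifs
    · exact key _ _ _ hc
    · exact key _ _ _ hc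
    · exact ⟨A, h.pop hc _⟩

theorem Valid.iterate (hadj : ∀ u v, adj u v → v < n) {r : ℕ} (i : ℕ) {A : Finset ℕ} {c : Config}
    (h : Valid n adj r A c) : ∃ A', Valid n adj r A' ((LeafSearch.step n adj)^[i] c) := by
  induction i generalizing A c with
  | zero => exact ⟨A, h⟩
  | succ i ih =>
    obtain ⟨A', h'⟩ := h.step hadj
    exact ih h'

/-- In a minimal witness an inner vertex has a fresh out-neighbour, and if there is just one then it
is an inner vertex as well. -/
theorem Valid.minimal {r k : ℕ} {A I B : Finset ℕ} {c : Config} (h : Valid n adj r A c)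
    (hadj : ∀ u v, adj u v → v < n) (hw : Witness adj r k I B)
    (hmin : ∀ I' B', Witness adj r k I' B' → I.card ≤ I'.card) (hAI : A ⊆ I) {u : ℕ}
    (huS : u ∈ c.seen) (huA : u ∉ A) (huI : u ∈ I) {x : ℕ} (hx : ∀ y ∈ fresh adj c.seen u n, y = x) :
    x ∈ fresh adj c.seen u n ∧ x ∈ I := by
  by_contra hcon
  have hcon' : ∀ y ∈ fresh adj c.seen u n, y ∉ I := by
    intro y hy hyI
    obtain rfl := hx y hy
    exact hcon ⟨hy, hyI⟩
  obtain ⟨hI, hB, hk⟩ := hw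
  have hA' : A ⊆ I.erase u := fun a ha =>
    Finset.mem_erase.2 ⟨fun he => huA (he ▸ ha), hAI ha⟩
  have huN : ∀ y, adj u y → y ∈ c.seen ∨ y ∈ fresh adj c.seen u n := by
    intro y hy
    by_cases hs : y ∈ c.seen
    · exact Or.inl hs
    · exact Or.inr (mem_fresh.2 ⟨hadj _ _ hy, hy, hs⟩)
  -- A walk inside `I` that leaves `u` enters either a seen vertex, which is reachable through `A`
  -- without `u`, or a fresh one, which is not in `I`.
  have hreach : ReachableWithin adj r (I.erase u) := by
    have key : ∀ y, Relation.ReflTransGen (fun x y => x ∈ I ∧ adj x y) r y → y ∈ I →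
        Relation.ReflTransGen (fun x y => x ∈ I.erase u ∧ adj x y) r y := by
      intro y hy
      induction hy with
      | refl => exact fun _ => .refl
      | tail _ hab ih =>
        rename_i a b _
        intro hb
        by_cases ha : a = u
        · subst ha
          rcases huN b hab.2 with hs | hs
          · exact reachableWithin_mono hA' (h.reach_seen hs)
          · exact absurd hb (hcon' b hs)
        · exact (ih hab.1).tail ⟨Finset.mem_erase.2 ⟨ha, hab.1⟩, hab.2⟩
    intro a ha
    have := Finset.mem_of_mem_erase ha
    exact key a (hI a this) this
  have huB : u ∉ B := fun hu => (hB u hu).1 huI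
  -- The exchange: `u` becomes a boundary vertex and makes up for `x`, the only vertex whose link to
  -- the inner set can depend on `u`.
  have := hmin (I.erase u) (insert u (B.erase x)) ⟨hreach, ?_, ?_⟩
  · rw [Finset.card_erase_of_mem huI] at this
    have := Finset.card_pos.2 ⟨u, huI⟩
    omega
  · intro v hv
    rcases Finset.mem_insert.1 hv with rfl | hv
    · refine ⟨Finset.notMem_erase _ _, ?_⟩
      exact ((h.mem_seen _).1 huS).imp_right fun ⟨a, ha, hav⟩ => ⟨a, hA' ha, hav⟩
    · obtain ⟨hvx, hv⟩ := Finset.mem_erase.1 hv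
      refine ⟨fun hvI => (hB v hv).1 (Finset.mem_of_mem_erase hvI), ?_⟩
      rcases (hB v hv).2 with rfl | ⟨a, ha, hav⟩
      · exact Or.inl rfl
      · by_cases hau : a = u
        · subst hau
          rcases huN v hav with hs | hs
          · exact ((h.mem_seen _).1 hs).imp_right fun ⟨a, ha, hav⟩ => ⟨a, hA' ha, hav⟩
          · exact absurd (hx v hs) hvx
        · exact Or.inr ⟨a, Finset.mem_erase.2 ⟨hau, ha⟩, hav⟩
  · rw [Finset.card_insert_of_notMem fun hu => huB (Finset.mem_of_mem_erase hu)]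
    have := Finset.pred_card_le_card_erase (s := B) (a := x)
    omega

/-- Minimality is used twice: a vertex of the guide is never a dead end, and a single child again
belongs to the guide, so the forced move agrees with it. -/
theorem Follows.expand {r k : ℕ} {A I B : Finset ℕ} {c : Config} (hf : Follows I A c)
    (h : Valid n adj r A c) (hadj : ∀ u v, adj u v → v < n) (hw : Witness adj r k I B)
    (hmin : ∀ I' B', Witness adj r k I' B' → I.card ≤ I'.card) {u : ℕ} {rest : List ℕ}
    (hc : c.stack = u :: rest) (huI : u ∈ I) (b : ℕ) :
    (fresh adj c.seen u n).length ≠ 0 ∧ Follows I (insert u A) (expand n adj c u rest b) := by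
  have hu := h.stack_sub u (by simp [hc])
  have hm := fun x => h.minimal (x := x) hadj hw hmin hf.sub hu.1 hu.2 huI
  refine ⟨fun h0 => ?_, Finset.insert_subset huI hf.sub, fun v hv hvA hvr => ?_, fun hfo => ?_⟩
  -- With no fresh vertices the hypothesis on `x` is vacuous, so `0` is an arbitrary choice.
  · have h1 := List.length_eq_zero_iff.1 h0
    have := (hm 0 (by simp [h1])).1
    simp [h1] at this
  · simp only [LeafSearch.expand, List.mem_append, List.mem_reverse, Finset.mem_union,
      List.mem_toFinset, not_or, Finset.mem_insert] at hv hvA hvr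
    refine hf.red v (hv.resolve_right hvr.1) hvA.2 ?_
    simp [hc, hvA.1, hvr.2]
  · simp only [LeafSearch.expand, decide_eq_true_eq, List.length_eq_one_iff] at hfo
    obtain ⟨x, hx⟩ := hfo
    refine ⟨x, rest, by simp [LeafSearch.expand, hx], (hm x (by simp [hx])).2⟩

/-- `hi` bounds the steps: each pops one vertex, and what it pushes is matched by the growth of
`seen`. `he` bounds the bits: a pop shortens the stack by one; `d ≥ 2` children lower `stack - 2 *
leaves` by `d - 1`; a single child leaves it unchanged but sets `forced`. A forced move spends this
credit instead of a bit. -/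
theorem exists_guesses {r k : ℕ} {I B : Finset ℕ} (hadj : ∀ u v, adj u v → v < n)
    (hw : Witness adj r k I B) (hmin : ∀ I' B', Witness adj r k I' B' → I.card ≤ I'.card)
    (i : ℕ) (A : Finset ℕ) (c : Config) (e : ℕ) (h : Valid n adj r A c) (hf : Follows I A c)
    (hi : c.stack.length + n ≤ i + c.seen.card)
    (he : 2 * k + c.stack.length ≤ e + 2 * c.leaves + c.forced.toNat) :
    ∃ b < 2 ^ e, k ≤ ((step n adj)^[i] { c with bits := b }).leaves := by
  induction i generalizing A c e with
  | zero =>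
    have h1 : c.seen.card ≤ n := by
      have := Finset.card_le_card (t := Finset.range n) fun v hv => Finset.mem_range.2 (h.seen_lt v hv)
      simpa using this
    have h2 : c.stack = [] := List.length_eq_zero_iff.1 (by omega)
    exact ⟨0, by positivity, hf.le_leaves h hw h2⟩
  | succ i ih =>
    by_cases hL : k ≤ c.leaves
    · exact ⟨0, by positivity, hL.trans (le_leaves_iterate { c with bits := 0 } _)⟩
    rcases hc : c.stack with _ | ⟨u, rest⟩
    · exact absurd (hf.le_leaves h hw hc) hL
    -- In `hexp` below, the `+ 1` is paid either by the forced flag or by one bit.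
    have hlen : c.stack.length = rest.length + 1 := by simp [hc]
    have hexp : u ∈ I → ∀ e', 2 * k + c.stack.length ≤ e' + 1 + 2 * c.leaves →
        ∃ b < 2 ^ e', k ≤ ((step n adj)^[i] (expand n adj c u rest b)).leaves := by
      intro huI e' he'
      obtain ⟨h0, hf'⟩ := hf.expand h hadj hw hmin hc huI 0
      have h1 := card_union_fresh (n := n) (adj := adj) c.seen u
      refine ih (insert u A) (expand n adj c u rest 0) e' (h.expand hadj hc 0 h0) hf' ?_ ?_
      · simp only [expand, List.length_append, List.length_reverse]
        omega
      · simp only [expand, List.length_append, List.length_reverse]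
        rcases Nat.lt_or_ge 1 (fresh adj c.seen u n).length with h2 | h2
        · omega
        · have h3 : (fresh adj c.seen u n).length = 1 := by omega
          simp [h3]
          omega
    by_cases hfo : c.forced = true
    · obtain ⟨u', rest', hc', huI⟩ := hf.forced hfo
      obtain ⟨rfl, rfl⟩ := List.cons_eq_cons.1 (hc.symm.trans hc')
      simp only [hfo, Bool.toNat_true] at he
      obtain ⟨b, hb, hk⟩ := hexp huI e (by omega)
      refine ⟨b, hb, ?_⟩
      rw [Function.iterate_succ_apply]
      convert hk using 4
      simp [step, hfo, expand]
    · simp only [Bool.not_eq_true] at hfo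
      simp only [hfo, Bool.toNat_false] at he
      -- A bit is still available, because `leaves < k` and the stack is nonempty.
      obtain ⟨e, rfl⟩ : ∃ e', e = e' + 1 := ⟨e - 1, by omega⟩
      by_cases huI : u ∈ I
      · obtain ⟨b, hb, hk⟩ := hexp huI e (by omega)
        refine ⟨2 * b + 1, by rw [pow_succ]; omega, ?_⟩
        rw [Function.iterate_succ_apply]
        convert hk using 4
        have : (2 * b + 1) / 2 = b := by omega
        simp [step, hfo, expand, this]
      · obtain ⟨b, hb, hk⟩ := ih A { c with stack := rest } e (h.pop hc c.bits)
          (hf.pop hc huI hfo c.bits) (by simp only; omega) (by simp only [hfo, Bool.toNat_false]; omega)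
        refine ⟨2 * b, by rw [pow_succ]; omega, ?_⟩
        have hs : step n adj ⟨u :: rest, c.seen, c.forced, 2 * b, c.leaves⟩ =
            ⟨rest, c.seen, c.forced, b, c.leaves⟩ := by simp [step, hfo]
        rw [Function.iterate_succ_apply, hs]
        exact hk

/-- The search is correct. -/
theorem exists_leaves_iff (hadj : ∀ u v, adj u v → v < n) {r : ℕ} (hr : r < n) (k : ℕ) :
    (∃ b < 4 ^ k, k ≤ ((step n adj)^[n] (init r b)).leaves) ↔ HasBoundary adj r k := by
  constructor
  · rintro ⟨b, -, hb⟩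
    obtain ⟨A, hA⟩ := (valid_init hr b).iterate hadj n
    exact hA.hasBoundary hb
  · rintro ⟨I₀, B₀, hw₀⟩
    have hex : ∃ m I B, Witness adj r k I B ∧ I.card = m := ⟨_, I₀, B₀, hw₀, rfl⟩
    classical
    obtain ⟨I, B, hw, hI⟩ := Nat.find_spec hex
    have := exists_guesses hadj hw
      (fun I' B' hw' => hI ▸ Nat.find_min' hex ⟨I', B', hw', rfl⟩) n ∅ (init r 0) (2 * k)
      (valid_init hr 0) ⟨by simp, by simp [init], by simp [init]⟩ (by simp [init]; omega)
      (by simp [init])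
    rwa [pow_mul] at this

end LeafSearch

/-!
Total correctness of machine programs, with time bounds.
-/

namespace RAM

/-- Started in `s`, the program `p` halts within `T` steps in a state satisfying `Q`. -/
def Runs (p : Prog) (s : State) (T : ℕ) (Q : State → Prop) : Prop :=
  ∃ t s', Exec p s t s' ∧ t ≤ T ∧ Q s'

theorem Runs.mono {p : Prog} {s : State} {T T' : ℕ} {Q Q' : State → Prop} (h : Runs p s T Q)
    (hT : T ≤ T') (hQ : ∀ s', Q s' → Q' s') : Runs p s T' Q' := by
  obtain ⟨t, s', he, ht, hq⟩ := h
  exact ⟨t, s', he, ht.trans hT, hQ _ hq⟩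

theorem Runs.seq {p q : Prog} {s : State} {T T' : ℕ} {Q R : State → Prop} (h : Runs p s T R)
    (h' : ∀ s', R s' → Runs q s' T' Q) : Runs (.seq p q) s (T + T') Q := by
  obtain ⟨t, s', he, ht, hr⟩ := h
  obtain ⟨t', s'', he', ht', hq⟩ := h' s' hr
  exact ⟨_, _, he.seq he', by omega, hq⟩

theorem Runs.ite {x : ℕ} {p q : Prog} {s : State} {T : ℕ} {Q : State → Prop}
    (h : s.reg x ≠ 0 → Runs p s T Q) (h' : s.reg x = 0 → Runs q s T Q) :
    Runs (.ite x p q) s (T + 1) Q := by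
  by_cases hx : s.reg x = 0
  · obtain ⟨t, s', he, ht, hq⟩ := h' hx
    exact ⟨_, _, he.iteFalse hx, by omega, hq⟩
  · obtain ⟨t, s', he, ht, hq⟩ := h hx
    exact ⟨_, _, he.iteTrue hx, by omega, hq⟩

/-- The invariant is indexed by the round, so it fixes the exact number `N` of rounds and gives
termination and the time bound together. -/
theorem Runs.while {x : ℕ} {p : Prog} {T : ℕ} (N : ℕ) (I : ℕ → State → Prop)
    (hstep : ∀ i < N, ∀ s, I i s → s.reg x ≠ 0 ∧ Runs p s T (I (i + 1)))
    (hend : ∀ s, I N s → s.reg x = 0) {s : State} (h0 : I 0 s) :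
    Runs (.while x p) s (N * (T + 1) + 1) (I N) := by
  suffices h : ∀ j i s, i + j = N → I i s → Runs (.while x p) s (j * (T + 1) + 1) (I N) from
    h N 0 s (by omega) h0
  intro j
  induction j with
  | zero =>
    rintro i s rfl hI
    exact ⟨1, s, .whileFalse (hend s hI), by omega, hI⟩
  | succ j ih =>
    intro i s hij hI
    obtain ⟨hx, t, s', he, ht, hI'⟩ := hstep i (by omega) s hI
    obtain ⟨t', s'', he', ht', hq⟩ := ih (i + 1) s' (by omega) hI'
    exact ⟨_, _, .whileTrue hx he he', by rw [Nat.succ_mul]; omega, hq⟩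

/-- The effect of a sequence of elementary instructions. -/
def evals (l : List Instr) (s : State) : State := l.foldl (fun s i => i.eval s) s

@[simp] theorem evals_nil (s : State) : evals [] s = s := rfl

@[simp] theorem evals_cons (i : Instr) (l : List Instr) (s : State) :
    evals (i :: l) s = evals l (i.eval s) := rfl

@[simp] theorem State.mem_setReg (s : State) (x v : ℕ) : (s.setReg x v).mem = s.mem := rfl

@[simp] theorem State.reg_setMem (s : State) (a v : ℕ) : (s.setMem a v).reg = s.reg := rfl

@[simp] theorem State.reg_setReg_self (s : State) (x v : ℕ) : (s.setReg x v).reg x = v :=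
  Function.update_self ..

@[simp] theorem State.reg_setReg_of_ne (s : State) {x y : ℕ} (v : ℕ) (h : y ≠ x) :
    (s.setReg x v).reg y = s.reg y :=
  Function.update_of_ne h ..

theorem State.mem_setMem (s : State) (a v : ℕ) : (s.setMem a v).mem = Function.update s.mem a v :=
  rfl

/-- Elementary instructions followed by a program. -/
def Prog.before : List Instr → Prog → Prog
  | [], p => p
  | i :: l, p => .seq (.instr i) (Prog.before l p)

/-- A straight-line program. -/
def Prog.block (l : List Instr) : Prog := Prog.before l (.instr .skip)

theorem Runs.before {l : List Instr} {p : Prog} {s : State} {T : ℕ} {Q : State → Prop}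
    (h : Runs p (evals l s) T Q) : Runs (.before l p) s (l.length + T) Q := by
  induction l generalizing s with
  | nil => simpa [Prog.before] using h
  | cons i l ih =>
    have h1 : Runs (.instr i) s 1 (fun s' => s' = i.eval s) := ⟨1, _, .instr i s, le_rfl, rfl⟩
    refine (h1.seq (T' := l.length + T) (Q := Q) ?_).mono (by simp; omega) fun _ h => h
    rintro _ rfl
    exact ih h

theorem Runs.block {l : List Instr} {s : State} {Q : State → Prop} (h : Q (evals l s)) :
    Runs (.block l) s (l.length + 1) Q :=
  Runs.before ⟨1, _, .instr .skip _, le_rfl, h⟩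

end RAM

/-!
The machine program for the search. The registers are used as follows: `0` the length of the input,
`1` the parameter, `2` the number `n` of vertices, `3` the constant one, `4` the answer, `5` the
number of guesses, `6` the address of the stack, `7` the number of roots left, `8` the root times
`n`, `9` the address of the mark of the root, `10` the number of guesses left, `11` the guesses, `12`
the number of leaves, `13` whether the top of the stack is forced, `14` the number of search steps
left, `15` the current vertex times `n`, `16` the address of the free end of the stack, and `17` to
`23` are auxiliary. After the input, the memory holds the marks of the vertices that were seen, and
then the stack. Vertices are pushed on the stack as multiples of `n`.
-/

namespace LeafSearch

open RAM

/-- Look at one out-neighbour. -/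
def scanProg : Prog :=
  .before [.load 22 19, .load 23 20, .sub 22 22 23]
    (.seq (.ite 22 (.block [.store 20 3, .store 16 21, .add 16 16 3, .add 17 17 3]) (.block []))
      (.block [.add 19 19 3, .add 20 20 3, .add 21 21 2, .sub 18 18 3]))

/-- Make the current vertex an inner vertex. -/
def expandProg : Prog :=
  .before [.const 17 0, .copy 18 2, .copy 19 15, .copy 20 0, .const 21 0]
    (.seq (.while 18 scanProg) (.block [.sub 22 17 3, .add 12 12 22, .add 22 22 22, .sub 13 17 22]))

/-- One step of the search. -/
def stepProg : Prog :=
  .seq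
    (.before [.sub 22 16 6]
      (.ite 22
        (.before [.sub 16 16 3, .load 15 16]
          (.seq
            (.ite 13 (.block [.const 22 1])
              (.block [.half 22 11, .add 23 22 22, .sub 23 11 23, .copy 11 22, .copy 22 23]))
            (.ite 22 expandProg (.block []))))
        (.block [])))
    (.block [.sub 14 14 3])

/-- Start the search. -/
def initProg : Prog :=
  .before [.copy 18 2, .copy 20 0, .const 22 0]
    (.seq (.while 18 (.block [.store 20 22, .add 20 20 3, .sub 18 18 3]))
      (.block [.store 9 3, .store 6 8, .add 16 6 3, .const 12 1, .const 13 0, .copy 14 2,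
        .copy 11 10]))

/-- The search from one root with one sequence of guesses. -/
def guessProg : Prog :=
  .before [.sub 10 10 3]
    (.seq initProg
      (.seq (.while 14 stepProg)
        (.before [.sub 22 1 12] (.ite 22 (.block []) (.block [.const 4 1])))))

/-- The search from one root. -/
def rootProg : Prog :=
  .before [.copy 10 5]
    (.seq (.while 10 guessProg) (.block [.sub 7 7 3, .add 8 8 2, .add 9 9 3]))

/-- The search from all roots. -/
def searchProg : Prog :=
  .before [.const 5 1, .copy 18 1, .const 4 0]
    (.seq (.while 18 (.block [.add 5 5 5, .add 5 5 5, .sub 18 18 3]))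
      (.before [.add 6 0 2, .copy 7 2, .const 8 0, .copy 9 0]
        (.seq (.while 7 rootProg) (.block [.copy 0 4]))))

/-- Find the number of vertices, and search if the input is well-formed. -/
def mainProg : Prog :=
  .ite 1
    (.before [.const 3 1, .const 2 0, .const 17 0, .const 18 1, .copy 19 0]
      (.seq
        (.while 19
          (.block [.add 17 17 18, .add 18 18 3, .add 18 18 3, .add 2 2 3, .sub 19 0 17]))
        (.before [.sub 19 17 0] (.ite 19 (.block [.const 0 0]) searchProg))))
    (.block [.const 0 0])

/-! ### Memory layout and the representation of configurations. -/

/-- The adjacency relation presented by a word. -/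
def wordAdj (w : List Bool) (n u v : ℕ) : Prop := v < n ∧ w.getD (u * n + v) false = true

instance (w : List Bool) (n : ℕ) : DecidableRel (wordAdj w n) := fun _ _ =>
  inferInstanceAs (Decidable (_ ∧ _))

/-- A stack of multiples of `n` stored from the address `base` on. -/
def StackAt (mem : ℕ → ℕ) (n base : ℕ) : List ℕ → Prop
  | [] => True
  | u :: rest => mem (base + rest.length) = u * n ∧ StackAt mem n base rest

theorem StackAt.update {mem : ℕ → ℕ} {n base a x : ℕ} {l : List ℕ} (h : StackAt mem n base l)
    (ha : a < base ∨ base + l.length ≤ a) : StackAt (Function.update mem a x) n base l := by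
  induction l with
  | nil => trivial
  | cons u rest ih =>
    simp only [List.length_cons] at ha
    refine ⟨?_, ih h.2 (by omega)⟩
    rw [Function.update_of_ne (by omega)]
    exact h.1

/-- The memory holds the input, the marks of the vertices in `S`, and the stack `l`. -/
structure Stores (w : List Bool) (n : ℕ) (S : Finset ℕ) (l : List ℕ) (mem : ℕ → ℕ) : Prop where
  input : ∀ i < w.length, mem i = (w.getD i false).toNat
  marks : ∀ v < n, mem (w.length + v) = if v ∈ S then 1 else 0
  stack : StackAt mem n (w.length + n) l
  lt : ∀ v ∈ l, v < n

theorem Stores.push {w : List Bool} {n : ℕ} {S : Finset ℕ} {l : List ℕ} {mem : ℕ → ℕ}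
    (h : Stores w n S l mem) {v : ℕ} (hv : v < n) :
    Stores w n (insert v S) (v :: l) (Function.update (Function.update mem (w.length + v) 1)
      (w.length + n + l.length) (v * n)) := by
  refine ⟨fun i hi => ?_, fun x hx => ?_, ⟨by simp, ?_⟩, ?_⟩
  · rw [Function.update_of_ne (by omega), Function.update_of_ne (by omega), h.input i hi]
  · rw [Function.update_of_ne (by omega)]
    by_cases hxv : x = v
    · subst hxv; simp
    · rw [Function.update_of_ne (by omega), h.marks x hx]
      simp [hxv]
  · exact (h.stack.update (by omega)).update (by omega)
  · intro x hx
    rcases List.mem_cons.1 hx with rfl | hx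
    · exact hv
    · exact h.lt x hx

/-- The registers that are constant during the search. -/
structure Consts (w : List Bool) (n : ℕ) (s : State) : Prop where
  length : s.reg 0 = w.length
  vertices : s.reg 2 = n
  one : s.reg 3 = 1
  base : s.reg 6 = w.length + n

/-- Register `4` is exempt because it holds the answer, which may change between searches. -/
theorem Consts.congr {w : List Bool} {n : ℕ} {s s' : State} (h : Consts w n s)
    (hs : ∀ x < 7, x ≠ 4 → s'.reg x = s.reg x) : Consts w n s' :=
  ⟨(hs 0 (by omega) (by omega)).trans h.length, (hs 2 (by omega) (by omega)).trans h.vertices,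
    (hs 3 (by omega) (by omega)).trans h.one, (hs 6 (by omega) (by omega)).trans h.base⟩

/-- The state `s` represents the configuration `c` of the search. -/
structure Represents (w : List Bool) (n : ℕ) (c : Config) (s : State) : Prop where
  bits : s.reg 11 = c.bits
  leaves : s.reg 12 = c.leaves
  forced : s.reg 13 = c.forced.toNat
  top : s.reg 16 = w.length + n + c.stack.length
  stores : Stores w n c.seen c.stack s.mem

/-! ### Correctness and running time of the program, from the inner loop outwards. -/

theorem fresh_succ (adj : ℕ → ℕ → Prop) [DecidableRel adj] (S : Finset ℕ) (u i : ℕ) :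
    fresh adj S u (i + 1) = fresh adj S u i ++ if adj u i ∧ i ∉ S then [i] else [] := by
  simp only [fresh, List.range_succ, List.filter_append]
  split_ifs with h <;> simp [h]

/-- The state after the out-neighbours `0, …, i - 1` of `u` were looked at. -/
structure Scanned (w : List Bool) (n : ℕ) (S : Finset ℕ) (u : ℕ) (rest : List ℕ) (s₀ : State)
    (i : ℕ) (s : State) : Prop where
  frame : ∀ x < 16, s.reg x = s₀.reg x
  left : s.reg 18 = n - i
  entry : s.reg 19 = u * n + i
  mark : s.reg 20 = w.length + i
  vertex : s.reg 21 = i * n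
  count : s.reg 17 = (fresh (wordAdj w n) S u i).length
  top : s.reg 16 = w.length + n + ((fresh (wordAdj w n) S u i).length + rest.length)
  stores : Stores w n (S ∪ (fresh (wordAdj w n) S u i).toFinset)
    ((fresh (wordAdj w n) S u i).reverse ++ rest) s.mem

theorem runs_scan {w : List Bool} {n : ℕ} (hw : w.length = n * n) {S : Finset ℕ} {u : ℕ}
    (hu : u < n) {rest : List ℕ} {s₀ : State} (hc : Consts w n s₀) {i : ℕ} (hi : i < n) {s : State}
    (h : Scanned w n S u rest s₀ i s) :
    Runs scanProg s 20 (Scanned w n S u rest s₀ (i + 1)) := by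
  have h3 : s.reg 3 = 1 := (h.frame 3 (by omega)).trans hc.one
  have hlt : u * n + i < w.length := by
    rw [hw]; nlinarith
  have hE : s.mem (u * n + i) = if wordAdj w n u i then 1 else 0 := by
    rw [h.stores.input _ hlt]
    simp only [wordAdj, hi, true_and]
    cases w.getD (u * n + i) false <;> rfl
  -- The marks change during the scan, but so far only at vertices below `i`.
  have hM : s.mem (w.length + i) = if i ∈ S then 1 else 0 := by
    rw [h.stores.marks i hi]
    have : i ∉ fresh (wordAdj w n) S u i := fun hm => by
      have := (mem_fresh.1 hm).1
      omega
    simp [this]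
  refine Runs.mono (T := 3 + ((5 + 1) + 5)) (Runs.before (T := (5 + 1) + 5) (Runs.seq
    (R := fun s' => (∀ x < 16, s'.reg x = s₀.reg x) ∧ s'.reg 18 = n - i ∧ s'.reg 19 = u * n + i ∧
      s'.reg 20 = w.length + i ∧ s'.reg 21 = i * n ∧
      s'.reg 17 = (fresh (wordAdj w n) S u (i + 1)).length ∧
      s'.reg 16 = w.length + n + ((fresh (wordAdj w n) S u (i + 1)).length + rest.length) ∧
      Stores w n (S ∪ (fresh (wordAdj w n) S u (i + 1)).toFinset)
        ((fresh (wordAdj w n) S u (i + 1)).reverse ++ rest) s'.mem)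
    (Runs.ite (fun hx => ?_) (fun hx => ?_)) ?_)) (by omega) (fun _ h => h)
  -- The tested register is the matrix entry minus the mark, truncated: it is nonzero exactly for an
  -- unseen out-neighbour.
  · simp [Instr.eval, h.entry, h.mark, hE, hM] at hx
    have hcond : wordAdj w n u i ∧ i ∉ S := by
      split_ifs at hx <;> simp_all
    have hf : fresh (wordAdj w n) S u (i + 1) = fresh (wordAdj w n) S u i ++ [i] := by
      rw [fresh_succ, if_pos hcond]
    refine Runs.block ⟨fun x hx => ?_, ?_⟩
    · rw [← h.frame x hx]
      simp (disch := omega) [Instr.eval]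
    · have := h.stores.push hi
      simp [Instr.eval, State.mem_setMem, h.left, h.entry, h.mark, h.vertex, h.count, h.top, h3,
        hf] at this ⊢
      exact ⟨by omega, this⟩
  · simp [Instr.eval, h.entry, h.mark, hE, hM] at hx
    have hcond : ¬ (wordAdj w n u i ∧ i ∉ S) := by
      rintro ⟨h1, h2⟩
      simp [h1, h2] at hx
    have hf : fresh (wordAdj w n) S u (i + 1) = fresh (wordAdj w n) S u i := by
      rw [fresh_succ, if_neg hcond, List.append_nil]
    refine Runs.mono (T := 1) (Runs.block ⟨fun x hx => ?_, ?_⟩) (by omega) fun _ h => h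
    · rw [← h.frame x hx]
      simp (disch := omega) [Instr.eval]
    · rw [hf]
      simp only [Instr.eval, evals_cons, evals_nil, State.mem_setReg]
      simp [h.left, h.entry, h.mark, h.vertex, h.count, h.top, h.stores]
  · rintro s' ⟨hfr, h18, h19, h20, h21, h17, h16, hst⟩
    have h2' : s'.reg 2 = n := (hfr 2 (by omega)).trans hc.vertices
    have h3' : s'.reg 3 = 1 := (hfr 3 (by omega)).trans hc.one
    refine Runs.block ⟨fun x hx => ?_, ?_, ?_, ?_, ?_, ?_, ?_, ?_⟩
    · rw [← hfr x hx]
      simp (disch := omega) [Instr.eval]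
    all_goals simp [Instr.eval, h18, h19, h20, h21, h17, h16, h2', h3', hst]
    · rfl
    · rfl
    · rfl
    · ring

theorem runs_expand {w : List Bool} {n : ℕ} (hw : w.length = n * n) {u : ℕ} (hu : u < n)
    {rest : List ℕ} {c : Config} {b : ℕ} {s : State} (hc : Consts w n s) (hb : s.reg 11 = b)
    (hL : s.reg 12 = c.leaves) (h15 : s.reg 15 = u * n)
    (h16 : s.reg 16 = w.length + n + rest.length) (hst : Stores w n c.seen rest s.mem) :
    Runs expandProg s (21 * n + 11) fun s' => (∀ x < 11, s'.reg x = s.reg x) ∧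
      s'.reg 14 = s.reg 14 ∧ Represents w n (expand n (wordAdj w n) c u rest b) s' := by
  set s₀ := evals [.const 17 0, .copy 18 2, .copy 19 15, .copy 20 0, .const 21 0] s with hs₀
  have hfr₀ : ∀ x < 16, s₀.reg x = s.reg x := by
    intro x hx
    simp (disch := omega) [hs₀, Instr.eval]
  have hc₀ : Consts w n s₀ := hc.congr fun x hx _ => hfr₀ x (by omega)
  have h0 : Scanned w n c.seen u rest s₀ 0 s₀ := by
    constructor <;>
      simp [hs₀, Instr.eval, fresh, hc.length, hc.vertices, h15, h16, hst]
  refine Runs.mono (T := 5 + ((n * (20 + 1) + 1) + 5)) (Runs.before (Runs.seq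
    (Runs.while n (Scanned w n c.seen u rest s₀) (fun i hi s' hs' => ⟨?_, runs_scan hw hu hc₀ hi hs'⟩)
      (fun s' hs' => by simp [hs'.left]) h0) ?_)) (by omega) (fun _ h => h)
  · rw [hs'.left]; omega
  · intro s' hs'
    have hf := hs'.frame
    refine Runs.block ⟨fun x hx => ?_, ?_, ?_, ?_, ?_, ?_, ?_⟩
    · rw [← hfr₀ x (by omega), ← hf x (by omega)]
      simp (disch := omega) [Instr.eval]
    · rw [← hfr₀ 14 (by omega), ← hf 14 (by omega)]
      simp [Instr.eval]
    · rw [show (expand n (wordAdj w n) c u rest b).bits = b from rfl, ← hb,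
        ← hfr₀ 11 (by omega), ← hf 11 (by omega)]
      simp [Instr.eval]
    · have h12 := hf 12 (by omega)
      rw [hfr₀ 12 (by omega), hL] at h12
      have h3 := (hf 3 (by omega)).trans hc₀.one
      simp [Instr.eval, expand, hs'.count, h12, h3]
    · have h3 := (hf 3 (by omega)).trans hc₀.one
      simp only [Instr.eval, evals_cons, evals_nil, expand]
      simp only [State.reg_setReg_self, ne_eq, Nat.reduceEqDiff,
        not_false_eq_true, State.reg_setReg_of_ne, hs'.count, h3]
      -- For `d` fresh vertices the flag is computed as `d - 2 * (d - 1)` with truncation, which is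
      -- `1` for `d = 1` and `0` otherwise.
      by_cases h1 : (fresh (wordAdj w n) c.seen u n).length = 1
      · simp [h1]
      · simp only [h1, decide_false, Bool.toNat_false]
        omega
    · simp [Instr.eval, hs'.top, expand]
    · simpa [Instr.eval, expand] using hs'.stores

theorem runs_step {w : List Bool} {n : ℕ} (hw : w.length = n * n) {c : Config} {s : State}
    (hc : Consts w n s) (h : Represents w n c s) :
    Runs stepProg s (21 * n + 30) fun s' => (∀ x < 11, s'.reg x = s.reg x) ∧
      s'.reg 14 = s.reg 14 - 1 ∧ Represents w n (step n (wordAdj w n) c) s' := by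
  refine Runs.mono (T := (1 + ((2 + ((6 + 1) + ((21 * n + 11) + 1))) + 1)) + 2) (Runs.seq
    (R := fun s' => (∀ x < 11, s'.reg x = s.reg x) ∧
      s'.reg 14 = s.reg 14 ∧ Represents w n (step n (wordAdj w n) c) s')
    (Runs.before (Runs.ite (fun hx => ?_) (fun hx => ?_))) ?_) (by omega) (fun _ h => h)
  · rcases hcs : c.stack with _ | ⟨u, rest⟩
    · simp [Instr.eval, h.top, hc.base, hcs] at hx
    have htop := h.top
    obtain ⟨hin, hma, hsta, hlt⟩ := h.stores
    rw [hcs] at htop hsta hlt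
    obtain ⟨hmem, hsta⟩ := hsta
    have hu : u < n := hlt u (by simp)
    have hlt' : ∀ v ∈ rest, v < n := fun v hv => hlt v (by simp [hv])
    have hst' : Stores w n c.seen rest s.mem := ⟨hin, hma, hsta, hlt'⟩
    have h3 := hc.one
    simp only [List.length_cons] at htop
    refine Runs.before (Runs.seq
      (R := fun s' => (∀ x < 11, s'.reg x = s.reg x) ∧ s'.reg 14 = s.reg 14 ∧
        s'.reg 12 = c.leaves ∧ s'.reg 13 = c.forced.toNat ∧ s'.reg 15 = u * n ∧
        s'.reg 16 = w.length + n + rest.length ∧ s'.mem = s.mem ∧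
        s'.reg 11 = (if c.forced then c.bits else c.bits / 2) ∧
        s'.reg 22 = if c.forced then 1 else c.bits % 2)
      (Runs.ite (fun hx => ?_) (fun hx => ?_)) ?_)
    · simp [Instr.eval, h.forced] at hx
      refine Runs.mono (T := 2) (Runs.block ⟨fun x hx => ?_, ?_⟩) (by omega) fun _ h => h
      · simp (disch := omega) [Instr.eval]
      · simp [Instr.eval, h.bits, h.leaves, h.forced, hx, htop, h3, ← hmem, ← add_assoc]
    · simp [Instr.eval, h.forced] at hx
      refine Runs.block ⟨fun x hx => ?_, ?_⟩
      · simp (disch := omega) [Instr.eval]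
      · simp [Instr.eval, h.bits, h.leaves, h.forced, hx, htop, h3, ← hmem, ← add_assoc]
        omega
    · rintro s' ⟨hf, h14, h12, h13, h15, h16, hm, h11, h22⟩
      have hc' : Consts w n s' := hc.congr fun x hx _ => hf x (by omega)
      refine Runs.ite (fun hx => ?_) (fun hx => ?_)
      · refine (runs_expand hw hu hc' h11 h12 h15 h16 (hm ▸ hst')).mono le_rfl ?_
        rintro s'' ⟨hf', h14', hr⟩
        refine ⟨fun x hx => (hf' x hx).trans (hf x hx), h14'.trans h14, ?_⟩
        convert hr using 1
        rw [h22] at hx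
        unfold step
        simp only [hcs]
        split_ifs at hx ⊢ <;> first | rfl | omega
      · refine Runs.mono (T := 1) (Runs.block ⟨hf, h14, ?_⟩) (by omega) fun _ h => h
        rw [h22] at hx
        have hfo : c.forced = false := by
          by_contra hcon
          rw [if_pos (by simpa using hcon)] at hx
          omega
        simp only [hfo, Bool.false_eq_true, if_false] at hx h11
        have hstep : step n (wordAdj w n) c = { c with stack := rest, bits := c.bits / 2 } := by
          unfold step
          simp [hcs, hfo, hx]
        rw [hstep]
        exact ⟨h11, h12, h13, h16, hm ▸ hst'⟩
  · have hcs : c.stack = [] := by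
      simpa [Instr.eval, h.top, hc.base] using hx
    have hstep : step n (wordAdj w n) c = c := by
      unfold step
      simp [hcs]
    rw [hstep]
    refine Runs.mono (T := 1) (Runs.block ⟨fun x hx => ?_, ?_, ?_⟩) (by omega) fun _ h => h
    · simp (disch := omega) [Instr.eval]
    · simp [Instr.eval]
    · obtain ⟨h1, h2, h3, h4, h5⟩ := h
      constructor <;> simpa [Instr.eval]
  · rintro s' ⟨hf, h14, h1, h2, h3, h4, h5⟩
    have hone := (hf 3 (by omega)).trans hc.one
    refine Runs.block ⟨fun x hx => ?_, ?_, ?_⟩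
    · rw [← hf x hx]
      simp (disch := omega) [Instr.eval]
    · simp [Instr.eval, h14, hone]
    · constructor <;> simp [Instr.eval, h1, h2, h3, h4, h5]

/-- All marks are cleared, since an earlier search may have left some. Old stack entries need no
clearing: `Stores` constrains only cells below the free end. -/
theorem runs_init {w : List Bool} {n : ℕ} {r b : ℕ} (hr : r < n) {s : State} (hc : Consts w n s)
    (h8 : s.reg 8 = r * n) (h9 : s.reg 9 = w.length + r) (h10 : s.reg 10 = b)
    (hin : ∀ i < w.length, s.mem i = (w.getD i false).toNat) :
    Runs initProg s (5 * n + 12) fun s' => (∀ x < 11, s'.reg x = s.reg x) ∧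
      s'.reg 14 = n ∧ Represents w n (init r b) s' := by
  refine Runs.mono (T := 3 + ((n * (4 + 1) + 1) + 8)) (Runs.before (Runs.seq
    (Runs.while n (fun i s' => (∀ x < 11, s'.reg x = s.reg x) ∧ s'.reg 18 = n - i ∧
        s'.reg 20 = w.length + i ∧ s'.reg 22 = 0 ∧ (∀ j < w.length, s'.mem j = s.mem j) ∧
        ∀ v < i, s'.mem (w.length + v) = 0) ?_ ?_ ?_) ?_)) (by omega) (fun _ h => h)
  · rintro i hi s' ⟨hf, h18, h20, h22, hm, hv⟩
    have hone := (hf 3 (by omega)).trans hc.one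
    refine ⟨by omega, Runs.block ⟨fun x hx => ?_, ?_, ?_, ?_, fun j hj => ?_, fun v hv' => ?_⟩⟩
    · rw [← hf x hx]
      simp (disch := omega) [Instr.eval]
    · simp [Instr.eval, h18, hone]; rfl
    · simp [Instr.eval, h20, hone]; rfl
    · simp [Instr.eval, h22]
    · simp [Instr.eval, h20, State.mem_setMem]
      rw [Function.update_of_ne (by omega), hm j hj]
    · simp [Instr.eval, h20, h22, State.mem_setMem, Function.update_apply]
      intro hvi
      exact hv v (by omega)
  · rintro s' ⟨-, h18, -⟩
    omega
  · refine ⟨fun x hx => ?_, ?_⟩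
    · simp (disch := omega) [Instr.eval]
    · simp [Instr.eval, hc.vertices, hc.length]
  · rintro s' ⟨hf, h18, h20, h22, hm, hv⟩
    have g3 := (hf 3 (by omega)).trans hc.one
    have g2 := (hf 2 (by omega)).trans hc.vertices
    have g6 := (hf 6 (by omega)).trans hc.base
    have g8 := (hf 8 (by omega)).trans h8
    have g9 := (hf 9 (by omega)).trans h9
    have g10 := (hf 10 (by omega)).trans h10
    refine Runs.block ⟨fun x hx => ?_, ?_, ?_, ?_, ?_, ?_, ?_⟩
    · rw [← hf x hx]
      simp (disch := omega) [Instr.eval]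
    · simp [Instr.eval, g2]
    · simp [Instr.eval, g10, init]
    · simp [Instr.eval, init]
    · simp [Instr.eval, init]
    · simp [Instr.eval, init, g3, g6]
    · have hs : Stores w n ∅ [] s'.mem :=
        ⟨fun i hi => (hm i hi).trans (hin i hi), fun v hv' => by simp [hv v hv'], trivial, by simp⟩
      simpa [Instr.eval, State.mem_setMem, init, g3, g6, g8, g9] using hs.push hr

theorem runs_guess {w : List Bool} {n : ℕ} (hw : w.length = n * n) {r b k : ℕ} (hr : r < n)
    {s : State} (hc : Consts w n s) (h1 : s.reg 1 = k) (h8 : s.reg 8 = r * n)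
    (h9 : s.reg 9 = w.length + r) (h10 : s.reg 10 = b + 1)
    (hin : ∀ i < w.length, s.mem i = (w.getD i false).toNat) :
    Runs guessProg s (21 * (n * n) + 36 * n + 18) fun s' =>
      (∀ x < 10, x ≠ 4 → s'.reg x = s.reg x) ∧ s'.reg 10 = b ∧
      (∀ i < w.length, s'.mem i = (w.getD i false).toNat) ∧
      (s'.reg 4 ≠ 0 ↔ s.reg 4 ≠ 0 ∨
        k ≤ ((step n (wordAdj w n))^[n] (init r b)).leaves) := by
  set s₀ := evals [.sub 10 10 3] s with hs₀
  have hfr₀ : ∀ x < 10, s₀.reg x = s.reg x := by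
    intro x hx
    simp (disch := omega) [hs₀, Instr.eval]
  have hc₀ : Consts w n s₀ := hc.congr fun x hx _ => hfr₀ x (by omega)
  have h10' : s₀.reg 10 = b := by simp [hs₀, Instr.eval, h10, hc.one]
  have hin₀ : ∀ i < w.length, s₀.mem i = (w.getD i false).toNat := by
    simpa [hs₀, Instr.eval] using hin
  refine Runs.mono (T := 1 + ((5 * n + 12) + ((n * ((21 * n + 30) + 1) + 1) + (1 + (2 + 1)))))
    (Runs.before (Runs.seq (runs_init hr hc₀ ((hfr₀ 8 (by omega)).trans h8)
      ((hfr₀ 9 (by omega)).trans h9) h10' hin₀) ?_)) (by ring_nf; omega) (fun _ h => h)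
  rintro s₁ ⟨hf₁, h14, hr₁⟩
  refine Runs.seq (Runs.while n (fun i s' => (∀ x < 11, s'.reg x = s₀.reg x) ∧ s'.reg 14 = n - i ∧
    Represents w n ((step n (wordAdj w n))^[i] (init r b)) s') ?_ ?_ ⟨hf₁, h14, hr₁⟩) ?_
  · rintro i hi s' ⟨hf, h14, hrep⟩
    refine ⟨by omega, (runs_step hw (hc₀.congr fun x hx _ => hf x (by omega)) hrep).mono le_rfl ?_⟩
    rintro s'' ⟨hf', h14', hrep'⟩
    refine ⟨fun x hx => (hf' x hx).trans (hf x hx), by omega, ?_⟩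
    rwa [Function.iterate_succ_apply']
  · rintro s' ⟨-, h14, -⟩
    omega
  · rintro s' ⟨hf, -, hrep⟩
    have g1 : s'.reg 1 = k := by rw [hf 1 (by omega), hfr₀ 1 (by omega), h1]
    have g4 : s'.reg 4 = s.reg 4 := by rw [hf 4 (by omega), hfr₀ 4 (by omega)]
    have g10 : s'.reg 10 = b := by rw [hf 10 (by omega), h10']
    refine Runs.before (Runs.ite (fun hx => ?_) (fun hx => ?_))
    · simp [Instr.eval, hrep.leaves, g1] at hx
      refine Runs.mono (T := 1) (Runs.block ⟨fun x hx _ => ?_, ?_, ?_, ?_⟩) (by omega) fun _ h => h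
      · rw [← hfr₀ x hx, ← hf x (by omega)]
        simp (disch := omega) [Instr.eval]
      · simp [Instr.eval, g10]
      · simpa [Instr.eval] using hrep.stores.input
      · simp [Instr.eval, g4]
        omega
    · simp [Instr.eval, hrep.leaves, g1] at hx
      refine Runs.block ⟨fun x hx _ => ?_, ?_, ?_, ?_⟩
      · rw [← hfr₀ x hx, ← hf x (by omega)]
        simp (disch := omega) [Instr.eval]
      · simp [Instr.eval, g10]
      · simpa [Instr.eval] using hrep.stores.input
      · simp [Instr.eval]
        omega

theorem runs_root {w : List Bool} {n : ℕ} (hw : w.length = n * n) {r k P : ℕ} (hr : r < n)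
    {s : State} (hc : Consts w n s) (h1 : s.reg 1 = k) (h5 : s.reg 5 = P) (h8 : s.reg 8 = r * n)
    (h9 : s.reg 9 = w.length + r) (hin : ∀ i < w.length, s.mem i = (w.getD i false).toNat) :
    Runs rootProg s (P * (21 * (n * n) + 36 * n + 19) + 6) fun s' =>
      (∀ x < 7, x ≠ 4 → s'.reg x = s.reg x) ∧ s'.reg 7 = s.reg 7 - 1 ∧
      s'.reg 8 = (r + 1) * n ∧ s'.reg 9 = w.length + (r + 1) ∧
      (∀ i < w.length, s'.mem i = (w.getD i false).toNat) ∧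
      (s'.reg 4 ≠ 0 ↔ s.reg 4 ≠ 0 ∨
        ∃ b < P, k ≤ ((step n (wordAdj w n))^[n] (init r b)).leaves) := by
  refine Runs.mono (T := 1 + ((P * ((21 * (n * n) + 36 * n + 18) + 1) + 1) + 4))
    (Runs.before (Runs.seq (Runs.while P (fun i s' => (∀ x < 10, x ≠ 4 → s'.reg x = s.reg x) ∧
      s'.reg 10 = P - i ∧ (∀ i < w.length, s'.mem i = (w.getD i false).toNat) ∧
      (s'.reg 4 ≠ 0 ↔ s.reg 4 ≠ 0 ∨
        ∃ b < P, P - i ≤ b ∧ k ≤ ((step n (wordAdj w n))^[n] (init r b)).leaves)) ?_ ?_ ?_) ?_))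
    (by ring_nf; omega) (fun _ h => h)
  · rintro i hi s' ⟨hf, h10, hin', h4⟩
    have hsucc : s'.reg 10 = P - (i + 1) + 1 := by clear h4; omega
    refine ⟨by clear h4; omega, (runs_guess hw hr (b := P - (i + 1))
      (hc.congr fun x hx hx' => hf x (by omega) hx') ((hf 1 (by omega) (by omega)).trans h1)
      ((hf 8 (by omega) (by omega)).trans h8) ((hf 9 (by omega) (by omega)).trans h9) hsucc
      hin').mono le_rfl ?_⟩
    rintro s'' ⟨hf', h10', hin'', h4'⟩
    refine ⟨fun x hx hx' => (hf' x hx hx').trans (hf x hx hx'), h10', hin'', h4'.trans ?_⟩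
    rw [h4, or_assoc]
    clear h4 h4'
    -- The guesses are tried downwards, so after `i` rounds those from `P - i` to `P - 1` are done.
    refine or_congr_right ⟨?_, ?_⟩
    · rintro (⟨b, hb, hb', hk⟩ | hk)
      · exact ⟨b, hb, by omega, hk⟩
      · exact ⟨_, by omega, le_rfl, hk⟩
    · rintro ⟨b, hb, hb', hk⟩
      rcases eq_or_lt_of_le hb' with rfl | hlt
      · exact Or.inr hk
      · exact Or.inl ⟨b, hb, by omega, hk⟩
  · rintro s' ⟨-, h10, -⟩
    omega
  · refine ⟨fun x hx _ => ?_, ?_, ?_, ?_⟩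
    · simp (disch := omega) [Instr.eval]
    · simp [Instr.eval, h5]
    · simpa [Instr.eval] using hin
    · simp [Instr.eval]
      intro b hb hb'
      omega
  · rintro s' ⟨hf, -, hin', h4⟩
    have g3 := (hf 3 (by omega) (by omega)).trans hc.one
    have g2 := (hf 2 (by omega) (by omega)).trans hc.vertices
    have g7 := hf 7 (by omega) (by omega)
    have g8 := (hf 8 (by omega) (by omega)).trans h8
    have g9 := (hf 9 (by omega) (by omega)).trans h9
    refine Runs.block ⟨fun x hx hx' => ?_, ?_, ?_, ?_, ?_, ?_⟩
    · rw [← hf x (by omega) hx']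
      simp (disch := omega) [Instr.eval]
    · simp [Instr.eval, g3, g7]
    · simp [Instr.eval, g2, g8, Nat.succ_mul]
    · simp [Instr.eval, g3, g9, add_assoc]
    · simpa [Instr.eval] using hin'
    · simpa [Instr.eval] using h4

theorem runs_search {w : List Bool} {n : ℕ} (hw : w.length = n * n) {k : ℕ} {s : State}
    (h0 : s.reg 0 = w.length) (h1 : s.reg 1 = k) (h2 : s.reg 2 = n) (h3 : s.reg 3 = 1)
    (hin : ∀ i < w.length, s.mem i = (w.getD i false).toNat) :
    Runs searchProg s (5 * k + n * (4 ^ k * (21 * (n * n) + 36 * n + 19) + 7) + 11) fun s' =>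
      (s'.reg 0 ≠ 0 ↔ ∃ r < n, ∃ b < 4 ^ k,
        k ≤ ((step n (wordAdj w n))^[n] (init r b)).leaves) := by
  refine Runs.mono (T := 3 + ((k * (4 + 1) + 1) +
      (4 + ((n * ((4 ^ k * (21 * (n * n) + 36 * n + 19) + 6) + 1) + 1) + 2))))
    (Runs.before (Runs.seq (Runs.while k (fun i s' => (∀ x < 4, s'.reg x = s.reg x) ∧
      s'.reg 4 = 0 ∧ s'.reg 5 = 4 ^ i ∧ s'.reg 18 = k - i ∧ s'.mem = s.mem) ?_ ?_ ?_) ?_))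
    (by ring_nf; omega) (fun _ h => h)
  · rintro i hi s' ⟨hf, h4, h5, h18, hm⟩
    have g3 := (hf 3 (by omega)).trans h3
    refine ⟨by omega, Runs.block ⟨fun x hx => ?_, ?_, ?_, ?_, ?_⟩⟩
    · rw [← hf x hx]
      simp (disch := omega) [Instr.eval]
    · simp [Instr.eval, h4]
    -- Without multiplication, the number `4 ^ k` of guesses is built by doubling twice in each of
    -- `k` rounds.
    · simp [Instr.eval, h5]
      ring
    · simp [Instr.eval, h18, g3]
      rfl
    · simp [Instr.eval, hm]
  · rintro s' ⟨-, -, -, h18, -⟩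
    omega
  · refine ⟨fun x hx => ?_, ?_⟩
    · simp (disch := omega) [Instr.eval]
    · simp [Instr.eval, h1]
  · rintro s' ⟨hf, h4, h5, -, hm⟩
    have g0 := (hf 0 (by omega)).trans h0
    have g1 := (hf 1 (by omega)).trans h1
    have g2 := (hf 2 (by omega)).trans h2
    have g3 := (hf 3 (by omega)).trans h3
    refine Runs.before (Runs.seq (Runs.while n (fun i s'' => Consts w n s'' ∧ s''.reg 1 = k ∧
      s''.reg 5 = 4 ^ k ∧ s''.reg 7 = n - i ∧ s''.reg 8 = i * n ∧ s''.reg 9 = w.length + i ∧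
      (∀ i < w.length, s''.mem i = (w.getD i false).toNat) ∧
      (s''.reg 4 ≠ 0 ↔ ∃ r < i, ∃ b < 4 ^ k,
        k ≤ ((step n (wordAdj w n))^[n] (init r b)).leaves)) ?_ ?_ ?_) ?_)
    · rintro i hi s'' ⟨hc, h1, h5, h7, h8, h9, hin', h4⟩
      refine ⟨by clear h4; omega, (runs_root hw hi hc h1 h5 h8 h9 hin').mono le_rfl ?_⟩
      rintro s''' ⟨hf', h7', h8', h9', hin'', h4'⟩
      refine ⟨hc.congr hf', (hf' 1 (by omega) (by omega)).trans h1,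
        (hf' 5 (by omega) (by omega)).trans h5, by clear h4 h4'; omega, h8', h9', hin'', h4'.trans ?_⟩
      rw [h4]
      clear h4 h4'
      constructor
      · rintro (⟨r, hr, h⟩ | h)
        · exact ⟨r, by omega, h⟩
        · exact ⟨i, by omega, h⟩
      · rintro ⟨r, hr, h⟩
        rcases Nat.lt_succ_iff_lt_or_eq.1 hr with hr | rfl
        · exact Or.inl ⟨r, hr, h⟩
        · exact Or.inr h
    · rintro s'' ⟨-, -, -, h7, -⟩
      omega
    · refine ⟨⟨?_, ?_, ?_, ?_⟩, ?_⟩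
      · simp [Instr.eval, g0]
      · simp [Instr.eval, g2]
      · simp [Instr.eval, g3]
      · simp [Instr.eval, g0, g2]
      · simpa [Instr.eval, g0, g1, g2, h4, h5, hm] using hin
    · rintro s'' ⟨-, -, -, -, -, -, -, h4⟩
      refine Runs.block ?_
      simpa [Instr.eval] using h4

theorem runs_main (w : List Bool) (k : ℕ) :
    Runs mainProg (initState w k) ((250 * 4 ^ k + 5 * k + 50) * (w.length + 1) ^ 3) fun s' =>
      (s'.reg 0 ≠ 0 ↔ 0 < k ∧ ∃ n, w.length = n * n ∧ ∃ r < n, ∃ b < 4 ^ k,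
        k ≤ ((step n (wordAdj w n))^[n] (init r b)).leaves) := by
  set l := w.length with hl
  have i0 : (initState w k).reg 0 = l := by simp [initState, hl]
  have i1 : (initState w k).reg 1 = k := by simp [initState]
  -- `N` is the square root of `l` rounded up. The machine finds it by adding successive odd numbers
  -- until the sum reaches `l`; then `l` is a square exactly if the sum does not exceed it.
  have hex : ∃ m, l ≤ m * m := ⟨l, Nat.le_mul_self l⟩
  obtain ⟨N, hN, hNmin⟩ : ∃ N, l ≤ N * N ∧ ∀ i < N, i * i < l :=
    ⟨Nat.find hex, Nat.find_spec hex, fun i hi => not_le.1 (Nat.find_min hex hi)⟩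
  have hNl : N ≤ l := by
    by_contra hcon
    have := hNmin l (by omega)
    exact absurd (Nat.le_mul_self l) (by omega)
  have hsq : ∀ n, l = n * n → n = N := by
    intro n hn
    rcases lt_trichotomy n N with h | h | h
    · have := hNmin n h; omega
    · exact h
    · have := Nat.mul_self_lt_mul_self h; omega
  have hX : l + 1 ≤ (l + 1) ^ 3 := Nat.le_self_pow (by omega) _
  have h4k : 1 ≤ 4 ^ k := Nat.one_le_pow _ _ (by omega)
  refine Runs.mono (T := (5 + ((N * (6 + 1) + 1) + (1 + ((5 * k +
      N * (4 ^ k * (21 * (N * N) + 36 * N + 19) + 7) + 11) + 1)))) + 1)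
    (Runs.ite (fun hk => ?_) (fun hk => ?_)) ?_ (fun _ h => h)
  · rw [i1] at hk
    refine Runs.before (Runs.seq (Runs.while N (fun i s' => s'.reg 0 = l ∧ s'.reg 1 = k ∧
      s'.reg 2 = i ∧ s'.reg 3 = 1 ∧ s'.reg 17 = i * i ∧ s'.reg 18 = 2 * i + 1 ∧
      s'.reg 19 = l - i * i ∧ s'.mem = (initState w k).mem) ?_ ?_ ?_) ?_)
    · rintro i hi s' ⟨h0, h1, h2, h3, h17, h18, h19, hm⟩
      have := hNmin i hi
      have h17' : i * i + (2 * i + 1) = (i + 1) * (i + 1) := by ring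
      refine ⟨by omega, Runs.block ?_⟩
      simp [Instr.eval, h0, h1, h2, h3, h17, h18, hm, h17']
      omega
    · rintro s' ⟨-, -, -, -, -, -, h19, -⟩
      omega
    · simp [Instr.eval, i0, i1]
    · rintro s' ⟨h0, h1, h2, h3, h17, -, -, hm⟩
      refine Runs.before (Runs.ite (fun hx => ?_) (fun hx => ?_))
      · simp [Instr.eval, h0, h17] at hx
        refine Runs.mono (T := 2) (Runs.block ?_) (by omega) fun _ h => h
        simp [Instr.eval]
        intro _ n hn
        obtain rfl := hsq n hn
        omega
      · simp [Instr.eval, h0, h17] at hx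
        have hlN : w.length = N * N := by omega
        refine (runs_search (w := w) (n := N) (k := k) hlN ?_ ?_ ?_ ?_ ?_).mono le_rfl ?_
        · simp [Instr.eval, h0, hl]
        · simp [Instr.eval, h1]
        · simp [Instr.eval, h2]
        · simp [Instr.eval, h3]
        · simp [Instr.eval, hm, initState]
        · intro s'' h
          rw [h]
          constructor
          · exact fun h => ⟨Nat.pos_of_ne_zero hk, N, hlN, h⟩
          · rintro ⟨-, n, hn, h'⟩
            obtain rfl := hsq n hn
            exact h'
  · rw [i1] at hk
    refine Runs.mono (T := 2) (Runs.block ?_) (by omega) fun _ h => h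
    simp [Instr.eval, hk]
  -- The exponent comes from the crude bound `N ≤ l`, and `76 = 21 + 36 + 19` collects the
  -- coefficients of one search.
  · have e1 : N * (4 ^ k * (21 * (N * N) + 36 * N + 19) + 7) ≤
        (l + 1) * (4 ^ k * (21 * ((l + 1) * (l + 1)) + 36 * (l + 1) + 19) + 7) := by gcongr <;> omega
    have e2 : (l + 1) * (4 ^ k * (21 * ((l + 1) * (l + 1)) + 36 * (l + 1) + 19) + 7) ≤
        4 ^ k * (76 * (l + 1) ^ 3) + 7 * (l + 1) ^ 3 := by
      have e3 : (l + 1) ^ 2 ≤ (l + 1) ^ 3 := Nat.pow_le_pow_right (by omega) (by omega)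
      have e4 : 21 * (l + 1) ^ 3 + 36 * (l + 1) ^ 2 + 19 * (l + 1) ≤ 76 * (l + 1) ^ 3 := by omega
      calc _ = 4 ^ k * (21 * (l + 1) ^ 3 + 36 * (l + 1) ^ 2 + 19 * (l + 1)) + 7 * (l + 1) := by ring
        _ ≤ _ := by gcongr
    have e5 : 5 * k ≤ 5 * k * (l + 1) ^ 3 := Nat.le_mul_of_pos_right _ (by positivity)
    have e6 : (l + 1) ^ 3 ≤ 4 ^ k * (l + 1) ^ 3 := Nat.le_mul_of_pos_left _ (by positivity)
    have e7 : (250 * 4 ^ k + 5 * k + 50) * (l + 1) ^ 3 =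
      250 * (4 ^ k * (l + 1) ^ 3) + 5 * k * (l + 1) ^ 3 + 50 * (l + 1) ^ 3 := by ring
    have e8 : 4 ^ k * (76 * (l + 1) ^ 3) = 76 * (4 ^ k * (l + 1) ^ 3) := by ring
    omega

end LeafSearch

namespace LeafSearch

/-! ### Words as adjacency matrices. -/

open Digraph

/-- The words of square length are the adjacency matrices of digraphs. -/
theorem exists_eq_encode {w : List Bool} {n : ℕ} (hw : w.length = n * n) :
    ∃ D : Digraph (Fin n), w = D.encode := by
  refine ⟨Digraph.mk fun u v => w.getD (u * n + v) false = true, List.ext_getElem ?_ ?_⟩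
  · simp [encode, hw]
  · intro i h1 h2
    have : (i / n) * n + i % n = i := by rw [mul_comm]; exact Nat.div_add_mod i n
    simp [encode, Fin.divNat, Fin.modNat, this, h1]

theorem length_encode {n : ℕ} (D : Digraph (Fin n)) : D.encode.length = n * n := by
  simp [encode]

theorem wordAdj_encode {n : ℕ} (D : Digraph (Fin n)) (u v : Fin n) :
    wordAdj D.encode n u v ↔ D.Adj u v := by
  have hlt : u.1 * n + v.1 < n * n := by
    have := u.2; have := v.2; nlinarith
  have hd : (u.1 * n + v.1) / n = u := by
    rw [mul_comm, Nat.mul_add_div (by have := u.2; omega), Nat.div_eq_of_lt v.2, add_zero]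
  have hm : (u.1 * n + v.1) % n = v := by
    rw [mul_comm, Nat.mul_add_mod, Nat.mod_eq_of_lt v.2]
  have hd' : (⟨u.1 * n + v.1, hlt⟩ : Fin (n * n)).divNat = u := Fin.ext hd
  have hm' : (⟨u.1 * n + v.1, hlt⟩ : Fin (n * n)).modNat = v := Fin.ext hm
  simp [wordAdj, encode, hlt, hd', hm']

/-- Sets of naturals cause no trouble: arcs of `wordAdj` end below `n` and so does the root, hence
every vertex of `A` and `B` is below `n`. -/
theorem hasBoundary_wordAdj {n : ℕ} (D : Digraph (Fin n)) (r : Fin n) (k : ℕ) :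
    HasBoundary (wordAdj D.encode n) r k ↔ HasBoundary D.Adj r k := by
  constructor
  · rintro ⟨A, B, hA, hB, hk⟩
    have hAn : ∀ a ∈ A, a < n := by
      intro a ha
      rcases Relation.ReflTransGen.cases_tail (hA a ha) with h | ⟨b, -, hb⟩
      · rw [h]; exact r.2
      · exact hb.2.1
    have hBn : ∀ v ∈ B, v < n := by
      intro v hv
      rcases (hB v hv).2 with rfl | ⟨a, -, hav⟩
      · exact r.2
      · exact hav.1
    refine ⟨A.attachFin hAn, B.attachFin hBn, ?_, ?_, by simpa using hk⟩
    · have key : ∀ v : ℕ, Relation.ReflTransGen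
          (fun x y => x ∈ A ∧ wordAdj D.encode n x y) r v → ∃ hv : v < n,
          Relation.ReflTransGen (fun x y => x ∈ A.attachFin hAn ∧ D.Adj x y) r ⟨v, hv⟩ := by
        intro v hv
        induction hv with
        | refl => exact ⟨r.2, .refl⟩
        | tail _ hab ih =>
          obtain ⟨ha, ih⟩ := ih
          refine ⟨hab.2.1, ih.tail ⟨by simpa using hab.1, ?_⟩⟩
          exact (wordAdj_encode D ⟨_, ha⟩ ⟨_, hab.2.1⟩).1 hab.2
      intro a ha
      exact (key a (hA a (by simpa using ha))).2
    · intro v hv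
      have hv' := hB v (by simpa using hv)
      refine ⟨by simpa using hv'.1, hv'.2.imp Fin.ext ?_⟩
      rintro ⟨a, ha, hav⟩
      exact ⟨⟨a, hAn a ha⟩, by simpa using ha, (wordAdj_encode D ⟨a, hAn a ha⟩ v).1 hav⟩
  · rintro ⟨A, B, hA, hB, hk⟩
    refine ⟨A.map Fin.valEmbedding, B.map Fin.valEmbedding, ?_, ?_, by simpa using hk⟩
    · intro a ha
      obtain ⟨a, ha', rfl⟩ := Finset.mem_map.1 ha
      refine Relation.ReflTransGen.lift Fin.val ?_ r a (hA a ha')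
      rintro x y ⟨hx, hxy⟩
      exact ⟨Finset.mem_map_of_mem Fin.valEmbedding hx, (wordAdj_encode D x y).2 hxy⟩
    · intro v hv
      obtain ⟨v, hv', rfl⟩ := Finset.mem_map.1 hv
      refine ⟨fun h => (hB v hv').1 ((Finset.mem_map' _).1 h),
        (hB v hv').2.imp (congrArg Fin.val) ?_⟩
      rintro ⟨a, ha, hav⟩
      exact ⟨a, Finset.mem_map_of_mem Fin.valEmbedding ha, (wordAdj_encode D a v).2 hav⟩

/-- The right-hand side is literally what the machine tests. Words of nonsquare length are excluded
on both sides, since every encoding has square length and every word of square length is an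
encoding. -/
theorem mem_kDMLOT_iff (w : List Bool) (k : ℕ) :
    (w, k) ∈ kDMLOT ↔ 0 < k ∧ ∃ n, w.length = n * n ∧ ∃ r < n, ∃ b < 4 ^ k,
      k ≤ ((step n (wordAdj w n))^[n] (init r b)).leaves := by
  refine and_congr_right fun hk => exists_congr fun n => ?_
  have key : ∀ D : Digraph (Fin n), k ≤ D.maxLeaves ↔ ∃ r < n, ∃ b < 4 ^ k,
      k ≤ ((step n (wordAdj D.encode n))^[n] (init r b)).leaves := by
    intro D
    rw [D.le_maxLeaves_iff_hasBoundary hk]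
    constructor
    · rintro ⟨r, hr⟩
      exact ⟨r, r.2, (exists_leaves_iff (fun _ _ h => h.1) r.2 k).2
        ((hasBoundary_wordAdj D r k).2 hr)⟩
    · rintro ⟨r, hr, h⟩
      exact ⟨⟨r, hr⟩, (hasBoundary_wordAdj D ⟨r, hr⟩ k).1
        ((exists_leaves_iff (fun _ _ h => h.1) hr k).1 h)⟩
  constructor
  · rintro ⟨D, rfl, h⟩
    exact ⟨length_encode D, (key D).1 h⟩
  · rintro ⟨hw, h⟩
    obtain ⟨D, rfl⟩ := exists_eq_encode hw
    exact ⟨D, rfl, (key D).2 h⟩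

end LeafSearch

theorem theorem4p4 : IsFPT kDMLOT := by
  refine ⟨LeafSearch.mainProg, fun k => 250 * 4 ^ k + 5 * k + 50, 3, fun w k => ?_⟩
  obtain ⟨t, s, he, ht, hs⟩ := LeafSearch.runs_main w k
  exact ⟨t, s, he, ht, hs.trans (LeafSearch.mem_kDMLOT_iff w k).symm⟩
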